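/- Let $d\ge 2$ and let $X_1,X_2,\dots$ be i.i.d. random vectors in $\mathbb R^d$ with a spherically symmetric distribution (invariant under all orthogonal maps). Let $(a_n)$ and $(b_n)$ be sequences of positive numbers with $b_n=o(a_n)$ such that, as $n\to\infty$, $$\mathbb P\bigl(|X_1|>a_n+t\,b_n\bigr)=\frac{1+o(1)}{n}\,e^{-t}$$ uniformly for all real $t$ with $|t|\le\frac{d-1}{2}\log(a_n/b_n)$, where $|\cdot|$ is the Euclidean norm. Put $$M_n^{(2)}=\max_{1\le i<j\le n}|X_i-X_j|,\qquad c_d=\frac{(d-1)\,2^{d-4}\,\Gamma(d/2)}{\sqrt\pi},$$ and for $\lambda\in\mathbb R$ and all $n$ large enough that $a_n/b_n>1$ put $$r_n(\lambda)=\frac{d-1}{2}\log\frac{a_n}{b_n}-\log\log\frac{a_n}{b_n}-\log c_d-\lambda .$$ Then: (i) for every $\lambda\in\mathbb R$, $\ \mathbb P\bigl(M_n^{(2)}\le 2a_n-b_n r_n(\lambda)\bigr)\to e^{-e^{-\lambda}}$; (ii) in other words, $$\frac{M_n^{(2)}-2a_n}{b_n}+\frac{d-1}{2}\log\frac{a_n}{b_n}-\log\log\frac{a_n}{b_n}-\log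 c_d$$ converges in distribution to a random variable $V$ with the Gumbel distribution $\mathbb P(V\le x)=e^{-e^{-x}}$, $x\in\mathbb R$; (iii) for every $\lambda\in\mathbb R$, the number of pairs $(i,j)$ with $1\le i<j\le n$ and $|X_i-X_j|>2a_n-b_n r_n(\lambda)$ converges in distribution to the Poisson distribution with mean $e^{-\lambda}$. -/

import Mathlib

open MeasureTheory ProbabilityTheory Filter Topology Asymptotics

/-- A measure on `ℝ^d` (with the Euclidean norm) is spherically symmetric if it is invariant under
every linear isometry of `ℝ^d`, i.e. under the orthogonal group `O(d)`. -/
def IsSphericallySymmetric {d : ℕ} (ν : Measure (EuclideanSpace ℝ (Fin d))) : Prop :=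
  ∀ U : EuclideanSpace ℝ (Fin d) ≃ₗᵢ[ℝ] EuclideanSpace ℝ (Fin d), ν.map U = ν

/-- The maximum interpoint distance `max_{i < j} |x i - x j|` of the first `n` points of a
sequence (it is `0` by convention if `n ≤ 1`, where there are no pairs). -/
noncomputable def maxInterpointDist {d : ℕ} (n : ℕ) (x : ℕ → EuclideanSpace ℝ (Fin d)) : ℝ :=
  ⨆ p : {p : Fin n × Fin n // p.1 < p.2}, ‖x p.1.1 - x p.1.2‖

/-- The number of pairs `i < j` among the first `n` points of a sequence with
`|x i - x j| > r`. -/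
noncomputable def numFarPairs {d : ℕ} (n : ℕ) (r : ℝ) (x : ℕ → EuclideanSpace ℝ (Fin d)) : ℕ :=
  (Finset.univ.filter fun p : Fin n × Fin n => p.1 < p.2 ∧ r < ‖x p.1 - x p.2‖).card

/-- The constant `c_d = (d - 1) 2^(d - 4) Γ(d / 2) / √π`. -/
noncomputable def maxDistConst (d : ℕ) : ℝ :=
  ((d : ℝ) - 1) * (2 : ℝ) ^ ((d : ℤ) - 4) * Real.Gamma ((d : ℝ) / 2) / √Real.pi

/-- The Gumbel distribution function `x ↦ exp (-exp (-x))`. -/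
noncomputable def gumbelCDF : StieltjesFunction ℝ where
  toFun x := Real.exp (-Real.exp (-x))
  mono' x y h := by
    simpa using h
  right_continuous' x := by
    have h : Continuous fun x : ℝ => Real.exp (-Real.exp (-x)) := by fun_prop
    exact h.continuousWithinAt

/-- The Gumbel distribution: the probability measure on `ℝ` with distribution function
`x ↦ exp (-exp (-x))`. -/
noncomputable def gumbelMeasure : Measure ℝ := gumbelCDF.measure

instance instIsProbabilityMeasureGumbel : IsProbabilityMeasure gumbelMeasure := by
  apply StieltjesFunction.isProbabilityMeasure
  · change Tendsto (fun x : ℝ => Real.exp (-Real.exp (-x))) atBot (𝓝 0)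
    exact Real.tendsto_exp_atBot.comp (tendsto_neg_atTop_atBot.comp
      (Real.tendsto_exp_atTop.comp tendsto_neg_atBot_atTop))
  · change Tendsto (fun x : ℝ => Real.exp (-Real.exp (-x))) atTop (𝓝 1)
    have h : Tendsto (fun x : ℝ => -Real.exp (-x)) atTop (𝓝 (-0)) :=
      (Real.tendsto_exp_atBot.comp tendsto_neg_atTop_atBot).neg
    simpa [Function.comp_def] using (Real.continuous_exp.tendsto _).comp h

/-!
# The limit law of the maximal interpoint distance

Write `m = d - 1`, `L = log (a / b)`, `s = (|x| - a) / b` for the rescaled radius, and let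
`2 a - b r` be the threshold distance. Two points with rescaled radii `s`, `t` are at distance more
than the threshold exactly when their directions are opposite up to a spherical cap of height about
`2 (b / a) (s + t + r)`, so by spherical symmetry (`measure_far_eq_lintegral_capProb`) this has
conditional probability about `capConst m * (4 (b / a) (s + t + r)₊) ^ (m / 2)`
(`exists_unit_capProb_bounds`). The cap asymptotics come from the rotation invariant weight
`exp (-|x| ^ 2)`, which factorizes along the axis of a cone. Since the rescaled radius has tail
`e ^ (-t) / n`, the layer-cake formula gives
`∬ (s + t + r)₊ ^ (m / 2) ≈ Γ (m / 2 + 1) r e ^ r / n ^ 2`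
(`lintegral_lintegral_rpow_le`, `le_lintegral_lintegral_rpow`): the sum `s + t` stays close
to `-r`, while `s` itself ranges over an interval of length about `r ≈ (m / 2) L`, which is where
the double logarithm comes from. The mean number of distant pairs therefore tends to `exp (-l)`
(`HasExpTail.tendsto_sq_mul_measure_farPairsSeq`).

The full mean is inflated by rare points with an exceptionally large radius, so the radii are first
truncated at `a + b A` with `A = (log L) / 2`. With high probability no point exceeds this radius,
and the tail hypothesis covers all rescaled radii that still matter. After truncation the expected
number of points distant from a fixed point is at most of order `e ^ A / L → 0`
(`HasExpTail.exists_section_bound`), so pairs that share a point are negligible, and the number of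
distant pairs is asymptotically Poisson (`tendsto_measureReal_pairCount`). The Poisson limit is
proved by the Chen–Stein idea in its most elementary form: the recursion
`(k + 1) P(W = k + 1) ≈ μ P(W = k)`, which together with tightness determines the limit. The maximal
distance is at most the threshold exactly when there is no distant pair, which gives the Gumbel law.
-/

/-! ### Poisson approximation for counts of pairs -/

open Classical in
/-- The number of index pairs `p ∈ S` such that `(x p.1, x p.2) ∈ B`. -/
noncomputable def pairCount {E : Type*} (B : Set (E × E)) (S : Finset (ℕ × ℕ)) (x : ℕ → E) : ℕ :=
  (S.filter fun p => (x p.1, x p.2) ∈ B).card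

/-- The index pairs `i < j < n`. -/
def orderedPairs (n : ℕ) : Finset (ℕ × ℕ) :=
  (Finset.range n ×ˢ Finset.range n).filter fun p => p.1 < p.2

/-- The pairs `i < j < n` that share no index with the pair `q`. -/
def pairsAvoiding (n : ℕ) (q : ℕ × ℕ) : Finset (ℕ × ℕ) :=
  (orderedPairs n).filter fun p => p.1 ≠ q.1 ∧ p.1 ≠ q.2 ∧ p.2 ≠ q.1 ∧ p.2 ≠ q.2

/-- The pairs `i < j < n` other than `q` that share an index with `q`. -/
def pairsMeeting (n : ℕ) (q : ℕ × ℕ) : Finset (ℕ × ℕ) :=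
  ((orderedPairs n).filter
    fun p => ¬ (p.1 ≠ q.1 ∧ p.1 ≠ q.2 ∧ p.2 ≠ q.1 ∧ p.2 ≠ q.2)).erase q

lemma mem_orderedPairs {n : ℕ} {p : ℕ × ℕ} : p ∈ orderedPairs n ↔ p.1 < p.2 ∧ p.2 < n := by
  simp only [orderedPairs, Finset.mem_filter, Finset.mem_product, Finset.mem_range]
  omega

lemma card_pairsMeeting_le (n : ℕ) (q : ℕ × ℕ) : (pairsMeeting n q).card ≤ 4 * n := by
  have h : pairsMeeting n q ⊆ (({q.1, q.2} : Finset ℕ) ×ˢ Finset.range n) ∪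
      (Finset.range n ×ˢ ({q.1, q.2} : Finset ℕ)) := by
    intro p hp
    simp only [pairsMeeting, Finset.mem_erase, Finset.mem_filter, mem_orderedPairs] at hp
    simp only [Finset.mem_union, Finset.mem_product, Finset.mem_insert, Finset.mem_singleton,
      Finset.mem_range]
    omega
  have h2 : ({q.1, q.2} : Finset ℕ).card ≤ 2 := Finset.card_le_two
  calc _ ≤ _ := Finset.card_le_card h
    _ ≤ _ := Finset.card_union_le _ _
    _ ≤ 2 * n + n * 2 := by
      rw [Finset.card_product, Finset.card_product, Finset.card_range]
      gcongr
    _ = 4 * n := by ring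

lemma card_orderedPairs (n : ℕ) : ((orderedPairs n).card : ℝ) = n * (n - 1) / 2 := by
  have h : orderedPairs n = ((Finset.range n).sigma fun j => Finset.range j).map
      ⟨fun s => (s.2, s.1), fun s t h => by
        cases s; cases t; simp only [Prod.mk.injEq] at h; obtain ⟨rfl, rfl⟩ := h; rfl⟩ := by
    ext ⟨i, j⟩
    simp only [mem_orderedPairs, Finset.mem_map, Finset.mem_sigma, Finset.mem_range,
      Sigma.exists]
    constructor
    · rintro ⟨h1, h2⟩
      exact ⟨j, i, ⟨h2, h1⟩, rfl⟩
    · rintro ⟨a, b, ⟨h1, h2⟩, h⟩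
      obtain ⟨rfl, rfl⟩ := Prod.mk.inj h
      exact ⟨h2, h1⟩
  rw [h, Finset.card_map, Finset.card_sigma]
  simp only [Finset.card_range]
  clear h
  induction n with
  | zero => simp
  | succ n ih => rw [Finset.sum_range_succ]; push_cast at ih ⊢; rw [ih]; ring

lemma pairCount_union {E : Type*} (B : Set (E × E)) (S T : Finset (ℕ × ℕ))
    (h : Disjoint S T) (x : ℕ → E) :
    pairCount B (S ∪ T) x = pairCount B S x + pairCount B T x := by
  classical
  unfold pairCount
  rw [Finset.filter_union, Finset.card_union_of_disjoint]
  exact Finset.disjoint_filter_filter h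

lemma pairCount_orderedPairs_eq {E : Type*} (B : Set (E × E)) {n : ℕ} {q : ℕ × ℕ}
    (hq : q ∈ orderedPairs n) (x : ℕ → E) :
    pairCount B (orderedPairs n) x
      = pairCount B {q} x + pairCount B (pairsMeeting n q) x
        + pairCount B (pairsAvoiding n q) x := by
  rw [← pairCount_union, ← pairCount_union]
  · congr 1
    ext p
    simp only [pairsMeeting, pairsAvoiding, Finset.mem_union, Finset.mem_singleton,
      Finset.mem_erase, Finset.mem_filter]
    by_cases h : p = q
    · subst h; simp [hq]
    · simp [h]; tauto
  · rw [Finset.disjoint_left]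
    intro p hp
    simp only [pairsMeeting, pairsAvoiding, Finset.mem_union, Finset.mem_singleton,
      Finset.mem_erase, Finset.mem_filter] at hp ⊢
    rcases hp with rfl | hp
    · simp
    · tauto
  · simp [pairsMeeting]

lemma pairCount_ne_zero_iff {E : Type*} (B : Set (E × E)) (S : Finset (ℕ × ℕ)) (x : ℕ → E) :
    pairCount B S x ≠ 0 ↔ ∃ p ∈ S, (x p.1, x p.2) ∈ B := by
  classical
  simp [pairCount, Finset.filter_eq_empty_iff]

lemma pairCount_singleton {E : Type*} (B : Set (E × E)) (q : ℕ × ℕ) (x : ℕ → E)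
    [Decidable ((x q.1, x q.2) ∈ B)] :
    pairCount B {q} x = if (x q.1, x q.2) ∈ B then 1 else 0 := by
  classical
  unfold pairCount
  rw [Finset.filter_singleton]
  split_ifs <;> simp

lemma measurable_pairCount {E : Type*} [MeasurableSpace E] {B : Set (E × E)}
    (hB : MeasurableSet B) (S : Finset (ℕ × ℕ)) :
    Measurable fun x : ℕ → E => pairCount B S x := by
  classical
  unfold pairCount
  simp_rw [Finset.card_filter]
  refine Finset.measurable_sum _ fun p _ => ?_
  refine Measurable.ite ?_ measurable_const measurable_const
  exact hB.preimage (by fun_prop : Measurable fun x : ℕ → E => (x p.1, x p.2))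

lemma pairCount_congr {E : Type*} (B : Set (E × E)) (S : Finset (ℕ × ℕ)) {x y : ℕ → E}
    (h : ∀ p ∈ S, x p.1 = y p.1 ∧ x p.2 = y p.2) : pairCount B S x = pairCount B S y := by
  classical
  unfold pairCount
  congr 1
  refine Finset.filter_congr fun p hp => ?_
  rw [(h p hp).1, (h p hp).2]

section

variable {Ω E : Type*} [MeasurableSpace Ω] [MeasurableSpace E] {P : Measure Ω}
  {X : ℕ → Ω → E}

/-- The event that the pair of indices `q` is counted. -/
def pairEvent (X : ℕ → Ω → E) (B : Set (E × E)) (q : ℕ × ℕ) : Set Ω :=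
  {ω | (X q.1 ω, X q.2 ω) ∈ B}

lemma measurableSet_pairEvent (hX : ∀ i, Measurable (X i)) {B : Set (E × E)}
    (hB : MeasurableSet B) (q : ℕ × ℕ) : MeasurableSet (pairEvent X B q) :=
  hB.preimage ((hX q.1).prodMk (hX q.2))

lemma measurable_pairCount_comp (hX : ∀ i, Measurable (X i)) {B : Set (E × E)}
    (hB : MeasurableSet B) (S : Finset (ℕ × ℕ)) :
    Measurable fun ω => pairCount B S fun i => X i ω :=
  (measurable_pairCount hB S).comp (measurable_pi_lambda _ hX)

/-- The pairs avoiding the indices of `q` are independent of the pair `q`. -/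
lemma indepFun_pairCount_pairsAvoiding [Nonempty E] (hX : ∀ i, Measurable (X i))
    (hind : iIndepFun X P) {B : Set (E × E)} (hB : MeasurableSet B) {n : ℕ} (q : ℕ × ℕ) :
    IndepFun (fun ω => (X q.1 ω, X q.2 ω))
      (fun ω => pairCount B (pairsAvoiding n q) fun i => X i ω) P := by
  classical
  set S : Finset ℕ := {q.1, q.2}
  set T : Finset ℕ := Finset.range n \ S
  have hST : Disjoint S T := Finset.disjoint_sdiff
  have h := hind.indepFun_finset S T hST hX
  have h1 : q.1 ∈ S := by simp [S]
  have h2 : q.2 ∈ S := by simp [S]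
  let φ : (S → E) → E × E := fun z => (z ⟨q.1, h1⟩, z ⟨q.2, h2⟩)
  let ext : (T → E) → ℕ → E := fun z k =>
    if hk : k ∈ T then z ⟨k, hk⟩ else Classical.arbitrary E
  have hext : Measurable ext := by
    refine measurable_pi_lambda _ fun k => ?_
    by_cases hk : k ∈ T
    · simpa [ext, hk] using measurable_pi_apply _
    · simp [ext, hk]
  have h3 := h.comp (φ := φ) (ψ := fun z => pairCount B (pairsAvoiding n q) (ext z))
    (by fun_prop) ((measurable_pairCount hB _).comp hext)
  refine h3.congr (Filter.EventuallyEq.rfl) (Filter.Eventually.of_forall fun ω => ?_)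
  refine pairCount_congr _ _ fun p hp => ?_
  simp only [pairsAvoiding, Finset.mem_filter, mem_orderedPairs] at hp
  have e1 : p.1 ∈ T := by simp [T, S]; omega
  have e2 : p.2 ∈ T := by simp [T, S]; omega
  simp [ext, e1, e2]

variable [IsProbabilityMeasure P]

lemma measure_pairEvent (hX : ∀ i, Measurable (X i)) (hind : iIndepFun X P)
    (hid : ∀ i, IdentDistrib (X i) (X 0) P P) {B : Set (E × E)} (hB : MeasurableSet B)
    {q : ℕ × ℕ} (hq : q.1 ≠ q.2) :
    P (pairEvent X B q) = ((P.map (X 0)).prod (P.map (X 0))) B := by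
  have h := (indepFun_iff_map_prod_eq_prod_map_map (hX q.1).aemeasurable
    (hX q.2).aemeasurable).1 (hind.indepFun hq)
  rw [(hid q.1).map_eq, (hid q.2).map_eq] at h
  rw [← h, Measure.map_apply ((hX q.1).prodMk (hX q.2)) hB]
  rfl

/-- If every section of a symmetric set `B` has measure at most `Q`, two counted pairs sharing one
index have joint probability at most `Q` times that of a single pair. -/
lemma measure_pairEvent_inter_le (hX : ∀ i, Measurable (X i)) (hind : iIndepFun X P)
    (hid : ∀ i, IdentDistrib (X i) (X 0) P P) {B : Set (E × E)} (hB : MeasurableSet B)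
    {Q : ENNReal} (hQ : ∀ x, P.map (X 0) {y | (x, y) ∈ B} ≤ Q)
    {i j k : ℕ} (hij : i ≠ j) (hik : i ≠ k) (hjk : j ≠ k) :
    P (pairEvent X B (i, j) ∩ pairEvent X B (i, k))
      ≤ ((P.map (X 0)).prod (P.map (X 0))) B * Q := by
  have hX2 : Measurable fun ω => (X i ω, X j ω) := (hX i).prodMk (hX j)
  have hI : IndepFun (fun ω => (X i ω, X j ω)) (X k) P :=
    hind.indepFun_prodMk hX i j k hik hjk
  have h := (indepFun_iff_map_prod_eq_prod_map_map hX2.aemeasurable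
    (hX k).aemeasurable).1 hI
  set C : Set ((E × E) × E) := {z | z.1 ∈ B ∧ (z.1.1, z.2) ∈ B} with hC
  have hCm : MeasurableSet C :=
    (hB.preimage measurable_fst).inter
      (hB.preimage (by fun_prop : Measurable fun z : (E × E) × E => (z.1.1, z.2)))
  have h1 : P (pairEvent X B (i, j) ∩ pairEvent X B (i, k))
      = (P.map fun ω => ((X i ω, X j ω), X k ω)) C := by
    rw [Measure.map_apply (hX2.prodMk (hX k)) hCm]; rfl
  have : IsProbabilityMeasure (P.map (X k)) := Measure.isProbabilityMeasure_map (hX k).aemeasurable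
  rw [h1, h, Measure.prod_apply hCm, (hid k).map_eq]
  have h2 : ∀ z : E × E, (P.map (X 0)) (Prod.mk z ⁻¹' C) ≤ B.indicator (fun _ => Q) z := by
    intro z
    by_cases hz : z ∈ B
    · rw [Set.indicator_of_mem hz]
      refine le_trans (measure_mono ?_) (hQ z.1)
      intro y hy
      exact hy.2
    · rw [Set.indicator_of_notMem hz]
      have : Prod.mk z ⁻¹' C = ∅ := by
        ext y; simp [hC, hz]
      simp [this]
  refine (lintegral_mono h2).trans ?_
  rw [lintegral_indicator hB, setLIntegral_const, mul_comm, Measure.map_apply hX2 hB]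
  have := measure_pairEvent hX hind hid hB (q := (i, j)) hij
  rw [← this]
  rfl

/-- The bound of `measure_pairEvent_inter_le` for all positions of the common index. -/
lemma measure_pairEvent_inter_le_of_mem (hX : ∀ i, Measurable (X i)) (hind : iIndepFun X P)
    (hid : ∀ i, IdentDistrib (X i) (X 0) P P) {B : Set (E × E)} (hB : MeasurableSet B)
    (hsymm : ∀ x y, (x, y) ∈ B → (y, x) ∈ B)
    {Q : ENNReal} (hQ : ∀ x, P.map (X 0) {y | (x, y) ∈ B} ≤ Q) {n : ℕ}
    {q p : ℕ × ℕ} (hq : q ∈ orderedPairs n) (hp : p ∈ pairsMeeting n q) :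
    P (pairEvent X B q ∩ pairEvent X B p)
      ≤ ((P.map (X 0)).prod (P.map (X 0))) B * Q := by
  have hsw : ∀ i j, pairEvent X B (i, j) = pairEvent X B (j, i) := fun i j =>
    Set.ext fun ω => ⟨fun h => hsymm _ _ h, fun h => hsymm _ _ h⟩
  obtain ⟨i, j⟩ := q
  obtain ⟨k, l⟩ := p
  simp only [pairsMeeting, Finset.mem_erase, Finset.mem_filter, mem_orderedPairs, ne_eq,
    Prod.mk.injEq] at hq hp
  have key : ∀ {i j k : ℕ}, i ≠ j → i ≠ k → j ≠ k → _ :=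
    fun {i j k} => measure_pairEvent_inter_le hX hind hid hB hQ (i := i) (j := j) (k := k)
  by_cases h1 : k = i
  · subst h1
    exact key (by omega) (by omega) (by omega)
  by_cases h2 : k = j
  · subst h2
    rw [hsw i k]
    exact key (by omega) (by omega) (by omega)
  by_cases h3 : l = i
  · subst h3
    rw [hsw k l]
    exact key (by omega) (by omega) (by omega)
  by_cases h4 : l = j
  · subst h4
    rw [hsw k l, hsw i l]
    exact key (by omega) (by omega) (by omega)
  · omega

lemma sum_measureReal_pairEvent_inter (hX : ∀ i, Measurable (X i)) {B : Set (E × E)}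
    (hB : MeasurableSet B) (S : Finset (ℕ × ℕ)) (k : ℕ) :
    ∑ q ∈ S, P.real (pairEvent X B q ∩ {ω | pairCount B S (fun i => X i ω) = k})
      = k * P.real {ω | pairCount B S (fun i => X i ω) = k} := by
  classical
  set C : Set Ω := {ω | pairCount B S (fun i => X i ω) = k}
  have hC : MeasurableSet C :=
    (measurable_pairCount_comp hX hB S) (measurableSet_singleton k)
  have hm : ∀ q, MeasurableSet (pairEvent X B q ∩ C) := fun q =>
    (measurableSet_pairEvent hX hB q).inter hC
  have h1 : ∀ q ∈ S, P.real (pairEvent X B q ∩ C)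
      = ∫ ω, (pairEvent X B q ∩ C).indicator (fun _ => (1 : ℝ)) ω ∂P := by
    intro q _
    rw [integral_indicator (hm q)]; simp
  rw [Finset.sum_congr rfl h1, ← integral_finsetSum]
  · have h2 : ∀ ω, ∑ q ∈ S, (pairEvent X B q ∩ C).indicator (fun _ => (1 : ℝ)) ω
        = C.indicator (fun _ => (k : ℝ)) ω := by
      intro ω
      by_cases hω : ω ∈ C
      · rw [Set.indicator_of_mem hω]
        have : (pairCount B S (fun i => X i ω) : ℝ) = k := by
          exact_mod_cast hω
        rw [← this, pairCount, Finset.card_filter]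
        push_cast
        refine Finset.sum_congr rfl fun q _ => ?_
        by_cases hq : (X q.1 ω, X q.2 ω) ∈ B
        · rw [Set.indicator_of_mem (show ω ∈ pairEvent X B q ∩ C from ⟨hq, hω⟩)]; simp [hq]
        · rw [Set.indicator_of_notMem (fun h => hq h.1)]; simp [hq]
      · rw [Set.indicator_of_notMem hω]
        exact Finset.sum_eq_zero fun q _ => Set.indicator_of_notMem (fun h => hω h.2) _
    simp_rw [h2]
    rw [integral_indicator hC]
    simp [mul_comm]
  · intro q _
    exact (integrable_const (1 : ℝ)).indicator (hm q)

/-- Chen–Stein recursion: for a Poisson variable `W` with mean `μ` one has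
`(k + 1) P(W = k + 1) = μ P(W = k)`; the count of pairs satisfies this up to a small error. -/
lemma abs_succ_mul_measureReal_pairCount_sub_le [Nonempty E] (hX : ∀ i, Measurable (X i))
    (hind : iIndepFun X P)
    (hid : ∀ i, IdentDistrib (X i) (X 0) P P) {B : Set (E × E)} (hB : MeasurableSet B)
    (hsymm : ∀ x y, (x, y) ∈ B → (y, x) ∈ B) {Q : ℝ} (hQ0 : 0 ≤ Q)
    (hQ : ∀ x, P.map (X 0) {y | (x, y) ∈ B} ≤ ENNReal.ofReal Q) {n : ℕ} (hn : 1 ≤ n) (k : ℕ) :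
    |(k + 1) * P.real {ω | pairCount B (orderedPairs n) (fun i => X i ω) = k + 1}
      - (orderedPairs n).card * ((P.map (X 0)).prod (P.map (X 0))).real B
        * P.real {ω | pairCount B (orderedPairs n) (fun i => X i ω) = k}|
      ≤ (orderedPairs n).card * ((P.map (X 0)).prod (P.map (X 0))).real B * (9 * n * Q) := by
  classical
  have : IsProbabilityMeasure (P.map (X 0)) := Measure.isProbabilityMeasure_map (hX 0).aemeasurable
  set ν := P.map (X 0)
  set p : ℝ := (ν.prod ν).real B with hp
  set W : Ω → ℕ := fun ω => pairCount B (orderedPairs n) (fun i => X i ω) with hW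
  set V : ℕ × ℕ → Ω → ℕ := fun q ω => pairCount B (pairsAvoiding n q) (fun i => X i ω) with hV
  have hWm : Measurable W := measurable_pairCount_comp hX hB _
  have hVm : ∀ q, Measurable (V q) := fun q => measurable_pairCount_comp hX hB _
  have hp0 : 0 ≤ p := measureReal_nonneg
  have hpA : ∀ q ∈ orderedPairs n, P.real (pairEvent X B q) = p := by
    intro q hq
    rw [mem_orderedPairs] at hq
    rw [hp, measureReal_def, measureReal_def, measure_pairEvent hX hind hid hB hq.1.ne]
  have hpQ : p ≤ Q := by
    rw [hp, measureReal_def]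
    refine ENNReal.toReal_le_of_le_ofReal hQ0 ?_
    rw [Measure.prod_apply hB]
    calc _ ≤ ∫⁻ _ : E, ENNReal.ofReal Q ∂ν := lintegral_mono fun x => hQ x
      _ = _ := by simp
  have hmeet : ∀ q ∈ orderedPairs n, ∀ r ∈ pairsMeeting n q,
      P.real (pairEvent X B q ∩ pairEvent X B r) ≤ p * Q := by
    intro q hq r hr
    have := measure_pairEvent_inter_le_of_mem hX hind hid hB hsymm hQ hq hr
    rw [measureReal_def]
    refine ENNReal.toReal_le_of_le_ofReal (by positivity) (this.trans (le_of_eq ?_))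
    rw [ENNReal.ofReal_mul hp0, hp, ofReal_measureReal]
  have hmem : ∀ q r, r ∈ pairsMeeting n q → r ∈ orderedPairs n := by
    intro q r hr
    simp only [pairsMeeting, Finset.mem_erase, Finset.mem_filter] at hr
    exact hr.2.1
  have hdec : ∀ q ∈ orderedPairs n, ∀ ω, W ω = (if (X q.1 ω, X q.2 ω) ∈ B then 1 else 0)
      + pairCount B (pairsMeeting n q) (fun i => X i ω) + V q ω := by
    intro q hq ω
    rw [hW, hV]
    simp only
    rw [pairCount_orderedPairs_eq B hq, pairCount_singleton]
  have hcard : ∀ q, ((pairsMeeting n q).card : ℝ) ≤ 4 * n := fun q => by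
    exact_mod_cast card_pairsMeeting_le n q
  -- replacing `W` by the independent count `V q` on the event of `q`
  have step1 : ∀ q ∈ orderedPairs n,
      |P.real (pairEvent X B q ∩ {ω | W ω = k + 1}) - P.real (pairEvent X B q ∩ {ω | V q ω = k})|
        ≤ 4 * n * (p * Q) := by
    intro q hq
    have hA := measurableSet_pairEvent hX hB q
    refine (abs_measureReal_sub_le_measureReal_symmDiff
      (hA.inter (hWm (measurableSet_singleton _))).nullMeasurableSet
      (hA.inter (hVm q (measurableSet_singleton _))).nullMeasurableSet).trans ?_
    have hs : symmDiff (pairEvent X B q ∩ {ω | W ω = k + 1}) (pairEvent X B q ∩ {ω | V q ω = k})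
        ⊆ ⋃ r ∈ pairsMeeting n q, (pairEvent X B q ∩ pairEvent X B r) := by
      intro ω hω
      have hωA : ω ∈ pairEvent X B q := by
        rcases hω with h | h
        · exact h.1.1
        · exact h.1.1
      have hne : pairCount B (pairsMeeting n q) (fun i => X i ω) ≠ 0 := by
        intro h0
        have := hdec q hq ω
        rw [h0, if_pos (show (X q.1 ω, X q.2 ω) ∈ B from hωA)] at this
        rcases hω with h | h
        · exact h.2 ⟨hωA, by have := h.1.2; simp only [Set.mem_ofPred_eq] at this ⊢; omega⟩
        · exact h.2 ⟨hωA, by have := h.1.2; simp only [Set.mem_ofPred_eq] at this ⊢; omega⟩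
      obtain ⟨r, hr, hrB⟩ := (pairCount_ne_zero_iff _ _ _).1 hne
      simp only [Set.mem_iUnion]
      exact ⟨r, hr, hωA, hrB⟩
    calc _ ≤ P.real (⋃ r ∈ pairsMeeting n q, (pairEvent X B q ∩ pairEvent X B r)) :=
          measureReal_mono hs (measure_ne_top _ _)
      _ ≤ ∑ r ∈ pairsMeeting n q, P.real (pairEvent X B q ∩ pairEvent X B r) :=
          measureReal_biUnion_finset_le _ _
      _ ≤ ∑ r ∈ pairsMeeting n q, p * Q := Finset.sum_le_sum fun r hr => hmeet q hq r hr
      _ = (pairsMeeting n q).card * (p * Q) := by rw [Finset.sum_const, nsmul_eq_mul]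
      _ ≤ _ := by gcongr; exact hcard q
  have step2 : ∀ q ∈ orderedPairs n, P.real (pairEvent X B q ∩ {ω | V q ω = k})
      = p * P.real {ω | V q ω = k} := by
    intro q hq
    have h := (indepFun_pairCount_pairsAvoiding hX hind hB (n := n) q).measure_inter_preimage_eq_mul
      B {k} hB (measurableSet_singleton k)
    rw [← hpA q hq, measureReal_def, measureReal_def, measureReal_def, ← ENNReal.toReal_mul]
    exact congrArg ENNReal.toReal h
  have step3 : ∀ q ∈ orderedPairs n,
      |P.real {ω | V q ω = k} - P.real {ω | W ω = k}| ≤ (4 * n + 1) * p := by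
    intro q hq
    refine (abs_measureReal_sub_le_measureReal_symmDiff
      (hVm q (measurableSet_singleton _)).nullMeasurableSet
      (hWm (measurableSet_singleton _)).nullMeasurableSet).trans ?_
    have hs : symmDiff {ω | V q ω = k} {ω | W ω = k}
        ⊆ (⋃ r ∈ pairsMeeting n q, pairEvent X B r) ∪ pairEvent X B q := by
      intro ω hω
      by_contra hcon
      simp only [Set.mem_union, Set.mem_iUnion, not_or, not_exists] at hcon
      have h0 : pairCount B (pairsMeeting n q) (fun i => X i ω) = 0 := by
        by_contra hne
        obtain ⟨r, hr, hrB⟩ := (pairCount_ne_zero_iff _ _ _).1 hne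
        exact hcon.1 r hr hrB
      have := hdec q hq ω
      rw [h0, if_neg (show (X q.1 ω, X q.2 ω) ∉ B from hcon.2)] at this
      rcases hω with h | h
      · exact h.2 (by have := h.1; simp only [Set.mem_ofPred_eq] at this ⊢; omega)
      · exact h.2 (by have := h.1; simp only [Set.mem_ofPred_eq] at this ⊢; omega)
    calc _ ≤ P.real ((⋃ r ∈ pairsMeeting n q, pairEvent X B r) ∪ pairEvent X B q) :=
          measureReal_mono hs (measure_ne_top _ _)
      _ ≤ P.real (⋃ r ∈ pairsMeeting n q, pairEvent X B r) + P.real (pairEvent X B q) :=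
          measureReal_union_le _ _
      _ ≤ (∑ r ∈ pairsMeeting n q, P.real (pairEvent X B r)) + p := by
          gcongr
          · exact measureReal_biUnion_finset_le _ _
          · exact (hpA q hq).le
      _ = (∑ r ∈ pairsMeeting n q, p) + p := by
          rw [Finset.sum_congr rfl fun r hr => hpA r (hmem q r hr)]
      _ = (pairsMeeting n q).card * p + p := by rw [Finset.sum_const, nsmul_eq_mul]
      _ ≤ 4 * n * p + p := by gcongr; exact hcard q
      _ = _ := by ring
  have step4 : ∀ q ∈ orderedPairs n,
      |P.real (pairEvent X B q ∩ {ω | W ω = k + 1}) - p * P.real {ω | W ω = k}|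
        ≤ p * (9 * n * Q) := by
    intro q hq
    have h1 := step1 q hq
    rw [step2 q hq] at h1
    have h3 : |p * P.real {ω | V q ω = k} - p * P.real {ω | W ω = k}|
        ≤ p * ((4 * n + 1) * p) := by
      rw [← mul_sub, abs_mul, abs_of_nonneg hp0]
      gcongr
      exact step3 q hq
    have hn' : (1 : ℝ) ≤ n := by exact_mod_cast hn
    calc _ ≤ 4 * n * (p * Q) + p * ((4 * n + 1) * p) := (abs_sub_le _ _ _).trans (add_le_add h1 h3)
      _ ≤ 4 * n * (p * Q) + p * ((4 * n + n) * Q) := by gcongr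
      _ = _ := by ring
  have hsum := sum_measureReal_pairEvent_inter (P := P) hX hB (orderedPairs n) (k + 1)
  have hcast : ((k + 1 : ℕ) : ℝ) = k + 1 := by push_cast; ring
  rw [hcast] at hsum
  rw [← hsum]
  have : ∑ q ∈ orderedPairs n, P.real (pairEvent X B q ∩ {ω | W ω = k + 1})
      - (orderedPairs n).card * p * P.real {ω | W ω = k}
      = ∑ q ∈ orderedPairs n, (P.real (pairEvent X B q ∩ {ω | W ω = k + 1})
          - p * P.real {ω | W ω = k}) := by
    rw [Finset.sum_sub_distrib, Finset.sum_const, nsmul_eq_mul]; ring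
  rw [this]
  refine (Finset.abs_sum_le_sum_abs _ _).trans ((Finset.sum_le_sum step4).trans ?_)
  rw [Finset.sum_const, nsmul_eq_mul]
  exact le_of_eq (by ring)

/-- Markov's inequality for the number of counted pairs. -/
lemma one_sub_div_le_sum_measureReal_pairCount (hX : ∀ i, Measurable (X i))
    (hind : iIndepFun X P)
    (hid : ∀ i, IdentDistrib (X i) (X 0) P P) {B : Set (E × E)} (hB : MeasurableSet B)
    (n K : ℕ) :
    1 - (orderedPairs n).card * ((P.map (X 0)).prod (P.map (X 0))).real B / (K + 1)
      ≤ ∑ k ∈ Finset.range (K + 1),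
        P.real {ω | pairCount B (orderedPairs n) (fun i => X i ω) = k} := by
  classical
  set W : Ω → ℕ := fun ω => pairCount B (orderedPairs n) (fun i => X i ω) with hW
  set p : ℝ := ((P.map (X 0)).prod (P.map (X 0))).real B with hp
  have hWm : Measurable W := measurable_pairCount_comp hX hB _
  have hpA : ∀ q ∈ orderedPairs n, P.real (pairEvent X B q) = p := by
    intro q hq
    rw [mem_orderedPairs] at hq
    rw [hp, measureReal_def, measureReal_def, measure_pairEvent hX hind hid hB hq.1.ne]
  have hWsum : ∀ ω, (W ω : ℝ)
      = ∑ q ∈ orderedPairs n, (pairEvent X B q).indicator (fun _ => (1 : ℝ)) ω := by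
    intro ω
    rw [hW]
    simp only [pairCount, Finset.card_filter]
    push_cast
    refine Finset.sum_congr rfl fun q _ => ?_
    simp [Set.indicator_apply, pairEvent]
  have hint : ∀ q ∈ orderedPairs n,
      Integrable ((pairEvent X B q).indicator (fun _ => (1 : ℝ))) P := fun q _ =>
    (integrable_const (1 : ℝ)).indicator (measurableSet_pairEvent hX hB q)
  have hEW : ∫ ω, (W ω : ℝ) ∂P = (orderedPairs n).card * p := by
    simp_rw [hWsum]
    rw [integral_finsetSum _ hint, Finset.sum_congr rfl fun q hq => by
      rw [integral_indicator (measurableSet_pairEvent hX hB q), setIntegral_const, smul_eq_mul,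
        mul_one, hpA q hq], Finset.sum_const, nsmul_eq_mul]
  have hWint : Integrable (fun ω => (W ω : ℝ)) P := by
    simp_rw [hWsum]
    exact integrable_finsetSum _ hint
  have hmarkov := mul_meas_ge_le_integral_of_nonneg
    (Filter.Eventually.of_forall fun ω => Nat.cast_nonneg (W ω)) hWint (K + 1 : ℝ)
  rw [hEW] at hmarkov
  have hsum : ∑ k ∈ Finset.range (K + 1), P.real {ω | W ω = k}
      = P.real {ω | W ω ≤ K} := by
    rw [← measureReal_biUnion_finset]
    · congr 1
      ext ω
      simp
    · intro i _ j _ hij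
      rw [Function.onFun, Set.disjoint_left]
      intro ω h1 h2
      exact hij (h1.symm.trans h2)
    · intro k _
      exact hWm (measurableSet_singleton _)
  have hcompl : P.real {ω | W ω ≤ K} = 1 - P.real {ω | (K + 1 : ℝ) ≤ W ω} := by
    have hm : MeasurableSet {ω | W ω ≤ K} := hWm measurableSet_Iic
    have h := probReal_compl_eq_one_sub (μ := P) hm
    have : {ω | (K + 1 : ℝ) ≤ W ω} = {ω | W ω ≤ K}ᶜ := by
      ext ω
      simp only [Set.mem_ofPred_eq, Set.mem_compl_iff, not_le]
      rw [← Nat.succ_le_iff]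
      norm_cast
    rw [this, h]; ring
  rw [hsum, hcompl]
  have : P.real {ω | (K + 1 : ℝ) ≤ W ω} ≤ (orderedPairs n).card * p / (K + 1) := by
    rw [le_div_iff₀ (by positivity), mul_comm]
    exact hmarkov
  linarith

end

/-- Probability weights on `ℕ` that asymptotically satisfy the recursion
`(k + 1) f (k + 1) = μ f k`, and are tight, converge to the Poisson weights. The recursion gives
`f k ≈ f 0 * μ ^ k / k!`, and `f 0` is then determined by the total mass. -/
lemma tendsto_poisson_weights_of_recursion {f : ℕ → ℕ → ℝ} {lam δ : ℕ → ℝ} {μ : ℝ}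
    (hμ : 0 ≤ μ)
    (h0 : ∀ n k, 0 ≤ f n k) (hlam : Tendsto lam atTop (𝓝 μ)) (hδ : Tendsto δ atTop (𝓝 0))
    (hrec : ∀ k, ∀ᶠ n in atTop, |(k + 1) * f n (k + 1) - lam n * f n k| ≤ δ n)
    (hsum : ∀ n K, ∑ k ∈ Finset.range (K + 1), f n k ≤ 1)
    (htail : ∀ n (K : ℕ), 1 - lam n / (K + 1) ≤ ∑ k ∈ Finset.range (K + 1), f n k) (k : ℕ) :
    Tendsto (fun n => f n k) atTop (𝓝 (Real.exp (-μ) * μ ^ k / k.factorial)) := by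
  have hf1 : ∀ n k, f n k ≤ 1 := fun n k =>
    (Finset.single_le_sum (fun i _ => h0 n i) (Finset.self_mem_range_succ k)).trans (hsum n k)
  have hdiff : ∀ k : ℕ,
      Tendsto (fun n => f n k - μ ^ k / k.factorial * f n 0) atTop (𝓝 0) := by
    intro k
    induction k with
    | zero => simp
    | succ k ih =>
      have hr : Tendsto (fun n => (k + 1) * f n (k + 1) - lam n * f n k) atTop (𝓝 0) :=
        squeeze_zero_norm' (by simpa using hrec k) hδ
      have hb : Tendsto (fun n => (lam n - μ) * f n k) atTop (𝓝 0) := by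
        have h1 : Tendsto (fun n => |lam n - μ|) atTop (𝓝 0) := by
          simpa using (hlam.sub_const μ).abs
        refine squeeze_zero_norm (fun n => ?_) h1
        rw [norm_mul, Real.norm_eq_abs, Real.norm_eq_abs, abs_of_nonneg (h0 n k)]
        exact mul_le_of_le_one_right (abs_nonneg _) (hf1 n k)
      have := ((hr.add hb).add (ih.const_mul μ)).div_const (k + 1 : ℝ)
      simp only [add_zero, mul_zero, zero_div] at this
      refine this.congr fun n => ?_
      have hk : (k + 1 : ℝ) ≠ 0 := by positivity
      have hk' : (k.factorial : ℝ) ≠ 0 := by positivity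
      rw [Nat.factorial_succ]
      push_cast
      field_simp
      ring
  have hf0 : Tendsto (fun n => f n 0) atTop (𝓝 (Real.exp (-μ))) := by
    have hser : Tendsto (fun K => ∑ k ∈ Finset.range (K + 1), μ ^ k / k.factorial) atTop
        (𝓝 (Real.exp μ)) := by
      have := (NormedSpace.expSeries_div_hasSum_exp μ).tendsto_sum_nat
      rw [← Real.exp_eq_exp_ℝ] at this
      exact this.comp (tendsto_add_atTop_nat 1)
    have hK : Tendsto (fun K : ℕ => (μ + 1) / ((K : ℝ) + 1)) atTop (𝓝 0) := by
      have := (tendsto_one_div_add_atTop_nhds_zero_nat (𝕜 := ℝ)).const_mul (μ + 1)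
      simpa [div_eq_mul_inv] using this
    have key : Tendsto (fun n => f n 0 * Real.exp μ) atTop (𝓝 1) := by
      rw [Metric.tendsto_atTop']
      intro ε hε
      obtain ⟨K, hK1, hK2⟩ := ((hser.eventually (lt_mem_nhds
        (show Real.exp μ - ε / 3 < Real.exp μ by linarith))).and
        (hK.eventually (gt_mem_nhds (show (0 : ℝ) < ε / 3 by positivity)))).exists
      set s := ∑ k ∈ Finset.range (K + 1), μ ^ k / k.factorial
      have hs : s ≤ Real.exp μ := by
        exact Real.sum_le_exp_of_nonneg hμ _
      have hsumdiff : Tendsto (fun n => ∑ k ∈ Finset.range (K + 1), f n k - s * f n 0) atTop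
          (𝓝 0) := by
        have := tendsto_finsetSum (Finset.range (K + 1)) fun k _ => hdiff k
        simp only [Finset.sum_const_zero] at this
        refine this.congr fun n => ?_
        rw [Finset.sum_sub_distrib, Finset.sum_mul]
      have h3 := hsumdiff.eventually (Metric.ball_mem_nhds 0 (show (0 : ℝ) < ε / 3 by positivity))
      have h4 := hlam.eventually (gt_mem_nhds (show μ < μ + 1 by linarith))
      obtain ⟨N, hN⟩ := eventually_atTop.1 (h3.and h4)
      refine ⟨N, fun n hn => ?_⟩
      obtain ⟨h5, h6⟩ := hN n hn.le
      rw [Real.dist_eq, sub_zero, abs_lt] at h5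
      have h7 : lam n / (K + 1) ≤ (μ + 1) / (K + 1) := by gcongr
      have h8 := hsum n K
      have h9 := htail n K
      have h10 : 0 ≤ f n 0 * (Real.exp μ - s) := mul_nonneg (h0 n 0) (by linarith)
      have h11 : f n 0 * (Real.exp μ - s) ≤ Real.exp μ - s :=
        mul_le_of_le_one_left (by linarith) (hf1 n 0)
      rw [Real.dist_eq, abs_lt]
      constructor <;> nlinarith
    have := key.mul_const (Real.exp (-μ))
    simp only [one_mul] at this
    refine this.congr fun n => ?_
    rw [mul_assoc, ← Real.exp_add]; simp
  have := (hdiff k).add (hf0.const_mul (μ ^ k / k.factorial))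
  rw [zero_add] at this
  convert! this using 2
  · ring
  · ring

/-- **Poisson limit theorem for pairs.** Let `B n` be symmetric sets. If the expected number
of pairs `i < j < n` with `(X i, X j) ∈ B n` tends to `μ`, while `n` times the largest section
measure of `B n` tends to `0`, then the number of such pairs is asymptotically Poisson. -/
lemma tendsto_measureReal_pairCount {Ω E : Type*} [MeasurableSpace Ω] [MeasurableSpace E]
    [Nonempty E] {P : Measure Ω} [IsProbabilityMeasure P] {X : ℕ → Ω → E}
    (hX : ∀ i, Measurable (X i)) (hind : iIndepFun X P)
    (hid : ∀ i, IdentDistrib (X i) (X 0) P P) {B : ℕ → Set (E × E)}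
    (hB : ∀ n, MeasurableSet (B n)) (hsymm : ∀ n x y, (x, y) ∈ B n → (y, x) ∈ B n)
    {Q : ℕ → ℝ} (hQ0 : ∀ n, 0 ≤ Q n)
    (hQ : ∀ᶠ n in atTop, ∀ x, P.map (X 0) {y | (x, y) ∈ B n} ≤ ENNReal.ofReal (Q n))
    (hQlim : Tendsto (fun n : ℕ => n * Q n) atTop (𝓝 0)) {μ : ℝ} (hμ : 0 ≤ μ)
    (hmean : Tendsto (fun n : ℕ => (n : ℝ) ^ 2 * ((P.map (X 0)).prod (P.map (X 0))).real (B n))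
      atTop (𝓝 (2 * μ))) (k : ℕ) :
    Tendsto (fun n => P.real {ω | pairCount (B n) (orderedPairs n) (fun i => X i ω) = k}) atTop
      (𝓝 (Real.exp (-μ) * μ ^ k / k.factorial)) := by
  set lam : ℕ → ℝ := fun n =>
    (orderedPairs n).card * ((P.map (X 0)).prod (P.map (X 0))).real (B n) with hlamdef
  have hlam : Tendsto lam atTop (𝓝 μ) := by
    have h1 : Tendsto (fun n : ℕ => (1 - ((n : ℝ))⁻¹) / 2) atTop (𝓝 ((1 - 0) / 2)) :=
      (tendsto_inv_atTop_nhds_zero_nat.const_sub 1).div_const 2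
    have h2 := hmean.mul h1
    rw [show 2 * μ * ((1 - 0) / 2) = μ by ring] at h2
    refine h2.congr' ?_
    filter_upwards [eventually_ge_atTop 1] with n hn
    have : (n : ℝ) ≠ 0 := by positivity
    simp only [hlamdef, card_orderedPairs]
    field_simp
  refine tendsto_poisson_weights_of_recursion (lam := lam) (δ := fun n => lam n * (9 * (n * Q n)))
    (f := fun n k => P.real {ω | pairCount (B n) (orderedPairs n) (fun i => X i ω) = k})
    hμ (fun _ _ => measureReal_nonneg) hlam ?_ ?_ ?_ ?_ k
  · simpa using hlam.mul (hQlim.const_mul 9)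
  · intro k
    filter_upwards [hQ, eventually_ge_atTop 1] with n hn hn1
    have := abs_succ_mul_measureReal_pairCount_sub_le hX hind hid (hB n) (hsymm n) (hQ0 n) hn hn1 k
    rw [← mul_assoc 9]
    exact this
  · intro n K
    rw [← measureReal_biUnion_finset]
    · exact measureReal_le_one
    · intro i _ j _ hij
      rw [Function.onFun, Set.disjoint_left]
      intro ω h1 h2
      exact hij (h1.symm.trans h2)
    · intro k _
      exact measurable_pairCount_comp hX (hB n) _ (measurableSet_singleton _)
  · intro n K
    exact one_sub_div_le_sum_measureReal_pairCount hX hind hid (hB n) n K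

/-! ### Measures on the line with an approximately exponential tail -/

lemma setOf_lt_max_add_zero {v w : ℝ} (hv : 0 < v) :
    {t : ℝ | v < max (w + t) 0} = Set.Ioi (v - w) := by
  ext t
  simp only [Set.mem_ofPred_eq, Set.mem_Ioi, lt_max_iff]
  constructor
  · rintro (h | h) <;> linarith
  · intro h
    left; linarith

lemma lintegral_max_add_rpow (μ : Measure ℝ) {p : ℝ} (hp : 0 < p) (w : ℝ) :
    ∫⁻ t, ENNReal.ofReal (max (w + t) 0 ^ p) ∂μ
      = ENNReal.ofReal p *
        ∫⁻ v in Set.Ioi 0, μ (Set.Ioi (v - w)) * ENNReal.ofReal (v ^ (p - 1)) := by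
  rw [lintegral_rpow_eq_lintegral_meas_lt_mul μ (f := fun t => max (w + t) 0)
    (Eventually.of_forall fun t => le_max_right _ _) (by fun_prop) hp]
  congr 1
  refine setLIntegral_congr_fun measurableSet_Ioi fun v hv => ?_
  rw [setOf_lt_max_add_zero hv]

lemma lintegral_exp_max_add_sub_one (μ : Measure ℝ) (w : ℝ) :
    ∫⁻ t, ENNReal.ofReal (Real.exp (max (w + t) 0) - 1) ∂μ
      = ∫⁻ v in Set.Ioi 0, μ (Set.Ioi (v - w)) * ENNReal.ofReal (Real.exp v) := by
  have h := lintegral_comp_eq_lintegral_meas_lt_mul μ (f := fun t => max (w + t) 0)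
    (g := Real.exp) (Eventually.of_forall fun t => le_max_right _ _) (by fun_prop)
    (fun t _ => Real.continuous_exp.intervalIntegrable _ _)
    (Eventually.of_forall fun t => (Real.exp_pos t).le)
  simp only [integral_exp, Real.exp_zero] at h
  rw [h]
  refine setLIntegral_congr_fun measurableSet_Ioi fun v hv => ?_
  rw [setOf_lt_max_add_zero hv]

/-- For `μ (t, ∞) = c e ^ (-t)` the integral would equal the right-hand side. -/
lemma lintegral_max_add_rpow_le {μ : Measure ℝ} {c p T w : ℝ} (hp : 0 < p) (hc : 0 ≤ c)
    (h : ∀ t, -T ≤ t → μ (Set.Ioi t) ≤ ENNReal.ofReal (c * Real.exp (-t))) (hw : w ≤ T) :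
    ∫⁻ t, ENNReal.ofReal (max (w + t) 0 ^ p) ∂μ
      ≤ ENNReal.ofReal (c * Real.Gamma (p + 1) * Real.exp w) := by
  rw [lintegral_max_add_rpow μ hp]
  have hint := (Real.GammaIntegral_convergent hp).const_mul (c * Real.exp w)
  calc _ ≤ ENNReal.ofReal p * ∫⁻ v in Set.Ioi (0 : ℝ),
        ENNReal.ofReal (c * Real.exp w * (Real.exp (-v) * v ^ (p - 1))) := by
        gcongr ENNReal.ofReal p * ?_
        refine setLIntegral_mono' measurableSet_Ioi fun v hv => ?_
        have hv' : (0 : ℝ) < v := hv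
        calc _ ≤ ENNReal.ofReal (c * Real.exp (-(v - w))) * ENNReal.ofReal (v ^ (p - 1)) := by
              gcongr
              exact h _ (by linarith)
          _ = _ := by
              rw [← ENNReal.ofReal_mul (by positivity)]
              congr 1
              rw [show -(v - w) = w + -v by ring, Real.exp_add]; ring
    _ = ENNReal.ofReal p * ENNReal.ofReal (c * Real.exp w * Real.Gamma p) := by
        rw [← ofReal_integral_eq_lintegral_ofReal hint, integral_const_mul,
          ← Real.Gamma_eq_integral hp]
        rw [EventuallyLE, ae_restrict_iff' measurableSet_Ioi]
        refine Eventually.of_forall fun v hv => ?_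
        have hv' : (0 : ℝ) < v := hv
        simp only [Pi.zero_apply]
        positivity
    _ = _ := by
        rw [← ENNReal.ofReal_mul hp.le, Real.Gamma_add_one hp.ne']
        congr 1; ring

/-- The Gamma integral for `Γ (p + 1)`, written as `p` times that for `Γ p`, truncated at `M`. -/
noncomputable def truncatedGamma (p M : ℝ) : ℝ :=
  p * ∫ v in Set.Ioc 0 M, Real.exp (-v) * v ^ (p - 1)

lemma tendsto_truncatedGamma {p : ℝ} (hp : 0 < p) :
    Tendsto (truncatedGamma p) atTop (𝓝 (Real.Gamma (p + 1))) := by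
  rw [Real.Gamma_add_one hp.ne', Real.Gamma_eq_integral hp]
  refine Tendsto.const_mul p ?_
  have := intervalIntegral_tendsto_integral_Ioi 0 (Real.GammaIntegral_convergent hp) tendsto_id
  refine this.congr' ?_
  filter_upwards [eventually_ge_atTop 0] with M hM
  rw [id, intervalIntegral.integral_of_le hM]

lemma truncatedGamma_nonneg {p : ℝ} (hp : 0 < p) (M : ℝ) : 0 ≤ truncatedGamma p M := by
  refine mul_nonneg hp.le (setIntegral_nonneg measurableSet_Ioc fun v hv => ?_)
  have := hv.1
  positivity

lemma le_lintegral_max_add_rpow {μ : Measure ℝ} {c p T M w : ℝ} (hp : 0 < p) (hc : 0 ≤ c)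
    (h : ∀ t, -T ≤ t → t ≤ M → ENNReal.ofReal (c * Real.exp (-t)) ≤ μ (Set.Ioi t))
    (hw0 : 0 ≤ w) (hw : w ≤ T) :
    ENNReal.ofReal (c * truncatedGamma p M * Real.exp w)
      ≤ ∫⁻ t, ENNReal.ofReal (max (w + t) 0 ^ p) ∂μ := by
  rw [lintegral_max_add_rpow μ hp]
  have hint := ((Real.GammaIntegral_convergent hp).mono_set
    (Set.Ioc_subset_Ioi_self : Set.Ioc 0 M ⊆ _)).const_mul (c * Real.exp w)
  calc _ = ENNReal.ofReal p * ENNReal.ofReal (∫ v in Set.Ioc (0 : ℝ) M,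
        (c * Real.exp w * (Real.exp (-v) * v ^ (p - 1)))) := by
        rw [← ENNReal.ofReal_mul hp.le, integral_const_mul, truncatedGamma]
        congr 1; ring
    _ = ENNReal.ofReal p * ∫⁻ v in Set.Ioc (0 : ℝ) M,
        ENNReal.ofReal (c * Real.exp w * (Real.exp (-v) * v ^ (p - 1))) := by
        rw [ofReal_integral_eq_lintegral_ofReal hint]
        rw [EventuallyLE, ae_restrict_iff' measurableSet_Ioc]
        refine Eventually.of_forall fun v hv => ?_
        have hv' : (0 : ℝ) < v := hv.1
        simp only [Pi.zero_apply]
        positivity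
    _ ≤ ENNReal.ofReal p * ∫⁻ v in Set.Ioc (0 : ℝ) M,
        μ (Set.Ioi (v - w)) * ENNReal.ofReal (v ^ (p - 1)) := by
        gcongr ENNReal.ofReal p * ?_
        refine setLIntegral_mono' measurableSet_Ioc fun v hv => ?_
        have hv' : (0 : ℝ) < v := hv.1
        calc _ = ENNReal.ofReal (c * Real.exp (-(v - w))) * ENNReal.ofReal (v ^ (p - 1)) := by
              rw [← ENNReal.ofReal_mul (by positivity)]
              congr 1
              rw [show -(v - w) = w + -v by ring, Real.exp_add]; ring
          _ ≤ _ := by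
              gcongr
              exact h _ (by linarith) (by linarith [hv.2])
    _ ≤ _ := by
        gcongr ENNReal.ofReal p * ?_
        exact lintegral_mono_set Set.Ioc_subset_Ioi_self

/-- For `μ (ds) = c e ^ (-s) ds` on `(-r - A, A]`, the integrand cancels the density and the integral
is `c e ^ r` times the length `2 A + r`; the extra `1` is a boundary term of the layer-cake
formula. -/
lemma setLIntegral_exp_add_le {μ : Measure ℝ} {c T A r : ℝ} (hc : 0 ≤ c)
    (h : ∀ t, -T ≤ t → μ (Set.Ioi t) ≤ ENNReal.ofReal (c * Real.exp (-t)))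
    (hA : μ (Set.Ioi A) = 0) (hrT : r + A ≤ T) (hrA : 0 ≤ 2 * A + r) :
    ∫⁻ s in Set.Ioi (-r - A), ENNReal.ofReal (Real.exp (r + s)) ∂μ
      ≤ ENNReal.ofReal (c * Real.exp r * (2 * A + r + 1)) := by
  have h1 : ∫⁻ s, ENNReal.ofReal (Real.exp (max (r + A + s) 0) - 1) ∂μ
      ≤ ENNReal.ofReal (c * Real.exp (r + A) * (2 * A + r)) := by
    rw [lintegral_exp_max_add_sub_one]
    calc _ ≤ ∫⁻ v in Set.Ioi (0 : ℝ), (Set.Ioc 0 (2 * A + r)).indicator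
          (fun _ => ENNReal.ofReal (c * Real.exp (r + A))) v := by
          refine setLIntegral_mono' measurableSet_Ioi fun v hv => ?_
          have hv' : (0 : ℝ) < v := hv
          by_cases hvA : v ≤ 2 * A + r
          · rw [Set.indicator_of_mem (show v ∈ Set.Ioc 0 (2 * A + r) from ⟨hv', hvA⟩)]
            calc _ ≤ ENNReal.ofReal (c * Real.exp (-(v - (r + A)))) * ENNReal.ofReal (Real.exp v) := by
                  gcongr
                  exact h _ (by linarith)
              _ = _ := by
                  rw [← ENNReal.ofReal_mul (by positivity), mul_assoc, ← Real.exp_add]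
                  congr 3; ring
          · have : μ (Set.Ioi (v - (r + A))) = 0 :=
              measure_mono_null (Set.Ioi_subset_Ioi (by linarith)) hA
            rw [this, zero_mul]
            exact zero_le
      _ ≤ ∫⁻ v, (Set.Ioc 0 (2 * A + r)).indicator
          (fun _ => ENNReal.ofReal (c * Real.exp (r + A))) v := setLIntegral_le_lintegral _ _
      _ = _ := by
          rw [lintegral_indicator measurableSet_Ioc, setLIntegral_const, Real.volume_Ioc, sub_zero,
            ← ENNReal.ofReal_mul (by positivity)]
  have h2 : μ (Set.Ioi (-r - A)) ≤ ENNReal.ofReal (c * Real.exp (r + A)) := by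
    refine (h _ (by linarith)).trans (le_of_eq ?_)
    congr 3; ring
  calc _ = ∫⁻ s in Set.Ioi (-r - A), ENNReal.ofReal (Real.exp (-A)) *
        (ENNReal.ofReal (Real.exp (max (r + A + s) 0) - 1) + 1) ∂μ := by
        refine setLIntegral_congr_fun measurableSet_Ioi fun s hs => ?_
        have hs' : -r - A < s := hs
        have h0 : (0 : ℝ) ≤ r + A + s := by linarith
        rw [max_eq_left h0, ← ENNReal.ofReal_one, ← ENNReal.ofReal_add _ zero_le_one,
          ← ENNReal.ofReal_mul (Real.exp_pos _).le, sub_add_cancel, ← Real.exp_add]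
        · congr 2; ring
        · linarith [Real.add_one_le_exp (r + A + s)]
    _ ≤ ENNReal.ofReal (Real.exp (-A)) *
        (∫⁻ s, ENNReal.ofReal (Real.exp (max (r + A + s) 0) - 1) ∂μ + μ (Set.Ioi (-r - A))) := by
        rw [lintegral_const_mul _ (by fun_prop), lintegral_add_left (by fun_prop),
          setLIntegral_const, one_mul]
        gcongr
        exact Measure.restrict_le_self
    _ ≤ ENNReal.ofReal (Real.exp (-A)) * (ENNReal.ofReal (c * Real.exp (r + A) * (2 * A + r))
        + ENNReal.ofReal (c * Real.exp (r + A))) := by gcongr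
    _ = _ := by
        rw [← ENNReal.ofReal_add (by positivity) (by positivity),
          ← ENNReal.ofReal_mul (by positivity)]
        congr 1
        rw [Real.exp_add, Real.exp_neg]
        field_simp

lemma le_setLIntegral_exp_add {μ : Measure ℝ} {c T M r : ℝ} (hc : 0 ≤ c)
    (h : ∀ t, -T ≤ t → t ≤ M → ENNReal.ofReal (c * Real.exp (-t)) ≤ μ (Set.Ioi t))
    (hM : 0 ≤ M) (hrT : r ≤ T) :
    ENNReal.ofReal (c * Real.exp r * r)
      ≤ ∫⁻ s in Set.Ioi (-r), ENNReal.ofReal (Real.exp (r + s)) ∂μ := by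
  calc _ = ∫⁻ v in Set.Ioc (0 : ℝ) r, ENNReal.ofReal (c * Real.exp r) := by
        rw [setLIntegral_const, Real.volume_Ioc, sub_zero, ← ENNReal.ofReal_mul (by positivity)]
    _ ≤ ∫⁻ v in Set.Ioc (0 : ℝ) r, μ (Set.Ioi (v - r)) * ENNReal.ofReal (Real.exp v) := by
        refine setLIntegral_mono' measurableSet_Ioc fun v hv => ?_
        calc _ = ENNReal.ofReal (c * Real.exp (-(v - r))) * ENNReal.ofReal (Real.exp v) := by
              rw [← ENNReal.ofReal_mul (by positivity), mul_assoc, ← Real.exp_add]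
              congr 3; ring
          _ ≤ _ := by
              gcongr
              exact h _ (by linarith [hv.1]) (by linarith [hv.2])
    _ ≤ ∫⁻ v in Set.Ioi (0 : ℝ), μ (Set.Ioi (v - r)) * ENNReal.ofReal (Real.exp v) :=
        lintegral_mono_set Set.Ioc_subset_Ioi_self
    _ = ∫⁻ s, ENNReal.ofReal (Real.exp (max (r + s) 0) - 1) ∂μ :=
        (lintegral_exp_max_add_sub_one μ r).symm
    _ ≤ ∫⁻ s, (Set.Ioi (-r)).indicator (fun s => ENNReal.ofReal (Real.exp (r + s))) s ∂μ := by
        refine lintegral_mono fun s => ?_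
        by_cases hs : -r < s
        · rw [Set.indicator_of_mem (show s ∈ Set.Ioi (-r) from hs), max_eq_left (by linarith)]
          exact ENNReal.ofReal_le_ofReal (by linarith)
        · rw [max_eq_right (by linarith)]
          simp
    _ = _ := lintegral_indicator measurableSet_Ioi _

/-- Upper bound in the asymptotics `∬ (s + t + r)₊ ^ p ∼ Γ (p + 1) r e ^ r` for a measure with
tail `≈ e ^ (-t)` truncated at `A`: the inner integral is about `Γ (p + 1) e ^ (r + s)`, and `s`
ranges over an interval of length about `r`. -/
lemma lintegral_lintegral_rpow_le {μ : Measure ℝ} {c p T A r : ℝ} (hp : 0 < p) (hc : 0 ≤ c)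
    (h : ∀ t, -T ≤ t → μ (Set.Ioi t) ≤ ENNReal.ofReal (c * Real.exp (-t)))
    (hA : μ (Set.Ioi A) = 0) (hrT : r + A ≤ T) (hrA : 0 ≤ 2 * A + r) :
    ∫⁻ s, ∫⁻ t, ENNReal.ofReal (max (r + s + t) 0 ^ p) ∂μ ∂μ
      ≤ ENNReal.ofReal (c ^ 2 * Real.Gamma (p + 1) * (Real.exp r * (2 * A + r + 1))) := by
  have hAe : ∀ᵐ t ∂μ, t ≤ A := by
    rw [ae_iff]; simpa [Set.Ioi] using hA
  have hG := (Real.Gamma_pos_of_pos (show 0 < p + 1 by linarith)).le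
  calc _ ≤ ∫⁻ s, (Set.Ioi (-r - A)).indicator
        (fun s => ENNReal.ofReal (c * Real.Gamma (p + 1)) * ENNReal.ofReal (Real.exp (r + s))) s ∂μ := by
        refine lintegral_mono_ae ?_
        filter_upwards [hAe] with s hs
        by_cases hsA : -r - A < s
        · rw [Set.indicator_of_mem (show s ∈ Set.Ioi (-r - A) from hsA),
            ← ENNReal.ofReal_mul (by positivity)]
          exact lintegral_max_add_rpow_le hp hc h (by linarith)
        · rw [Set.indicator_of_notMem (show s ∉ Set.Ioi (-r - A) from hsA)]
          refine le_of_eq (lintegral_eq_zero_of_ae_eq_zero ?_)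
          filter_upwards [hAe] with t ht
          rw [max_eq_right (by linarith), Real.zero_rpow hp.ne']
          simp
    _ = ENNReal.ofReal (c * Real.Gamma (p + 1)) *
        ∫⁻ s in Set.Ioi (-r - A), ENNReal.ofReal (Real.exp (r + s)) ∂μ := by
        rw [lintegral_indicator measurableSet_Ioi, lintegral_const_mul _ (by fun_prop)]
    _ ≤ ENNReal.ofReal (c * Real.Gamma (p + 1)) *
        ENNReal.ofReal (c * Real.exp r * (2 * A + r + 1)) := by
        gcongr
        exact setLIntegral_exp_add_le hc h hA hrT hrA
    _ = _ := by
        rw [← ENNReal.ofReal_mul (by positivity)]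
        congr 1; ring

/-- Lower bound matching `lintegral_lintegral_rpow_le`; the Gamma function is replaced by its
truncation at `M`, as the lower bound on the tail is only available up to `M`. -/
lemma le_lintegral_lintegral_rpow {μ : Measure ℝ} {c p T A M r : ℝ} (hp : 0 < p) (hc : 0 ≤ c)
    (h : ∀ t, -T ≤ t → t ≤ M → ENNReal.ofReal (c * Real.exp (-t)) ≤ μ (Set.Ioi t))
    (hA : μ (Set.Ioi A) = 0) (hM : 0 ≤ M) (hA0 : 0 ≤ A) (hrT : r + A ≤ T) :
    ENNReal.ofReal (c ^ 2 * truncatedGamma p M * (Real.exp r * r))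
      ≤ ∫⁻ s, ∫⁻ t, ENNReal.ofReal (max (r + s + t) 0 ^ p) ∂μ ∂μ := by
  have hAe : ∀ᵐ t ∂μ, t ≤ A := by
    rw [ae_iff]; simpa [Set.Ioi] using hA
  have hG := truncatedGamma_nonneg hp M
  calc _ = ENNReal.ofReal (c * truncatedGamma p M) * ENNReal.ofReal (c * Real.exp r * r) := by
        rw [← ENNReal.ofReal_mul (by positivity)]
        congr 1; ring
    _ ≤ ENNReal.ofReal (c * truncatedGamma p M) *
        ∫⁻ s in Set.Ioi (-r), ENNReal.ofReal (Real.exp (r + s)) ∂μ := by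
        gcongr
        exact le_setLIntegral_exp_add hc h hM (by linarith)
    _ = ∫⁻ s, (Set.Ioi (-r)).indicator
        (fun s => ENNReal.ofReal (c * truncatedGamma p M) * ENNReal.ofReal (Real.exp (r + s))) s ∂μ := by
        rw [lintegral_indicator measurableSet_Ioi, lintegral_const_mul _ (by fun_prop)]
    _ ≤ _ := by
        refine lintegral_mono_ae ?_
        filter_upwards [hAe] with s hs
        by_cases hsA : -r < s
        · rw [Set.indicator_of_mem (show s ∈ Set.Ioi (-r) from hsA),
            ← ENNReal.ofReal_mul (by positivity)]
          exact le_lintegral_max_add_rpow hp hc h (by linarith) (by linarith)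
        · rw [Set.indicator_of_notMem (show s ∉ Set.Ioi (-r) from hsA)]
          exact zero_le

/-! ### Spherical symmetry and the probability of a spherical cap -/

lemma exists_linearIsometryEquiv_apply_eq {E : Type*} [NormedAddCommGroup E]
    [InnerProductSpace ℝ E] {x y : E} (h : ‖x‖ = ‖y‖) :
    ∃ U : E ≃ₗᵢ[ℝ] E, U x = y :=
  ⟨_, Submodule.reflection_sub h⟩

section Cap

variable {E : Type*} [NormedAddCommGroup E] [InnerProductSpace ℝ E] [FiniteDimensional ℝ E]
  [MeasurableSpace E] [BorelSpace E]

/-- The rotation invariant measure with density `exp (-|x| ^ 2)`. It factorizes over orthogonal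
coordinates, and the normalized direction of a point drawn from it is uniform on the sphere. -/
noncomputable def gaussWeight (E : Type*) [NormedAddCommGroup E] [InnerProductSpace ℝ E]
    [FiniteDimensional ℝ E] [MeasurableSpace E] [BorelSpace E] : Measure E :=
  volume.withDensity fun x => ENNReal.ofReal (Real.exp (-‖x‖ ^ 2))

variable (E) in
lemma gaussWeight_univ :
    gaussWeight E Set.univ = ENNReal.ofReal (Real.pi ^ (Module.finrank ℝ E / 2 : ℝ)) := by
  have h := GaussianFourier.integral_rexp_neg_mul_sq_norm (V := E) (b := 1) one_pos
  have hint : Integrable fun v : E => Real.exp (-1 * ‖v‖ ^ 2) := by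
    by_contra hcon
    rw [integral_undef hcon] at h
    have : 0 < (Real.pi / 1) ^ (Module.finrank ℝ E / 2 : ℝ) :=
      Real.rpow_pos_of_pos (by simpa using Real.pi_pos) _
    exact this.ne h
  rw [gaussWeight, withDensity_apply _ MeasurableSet.univ, Measure.restrict_univ]
  simp only [neg_mul, one_mul, div_one] at h hint
  rw [← h, ofReal_integral_eq_lintegral_ofReal hint
    (Eventually.of_forall fun x => (Real.exp_pos _).le)]

instance : IsFiniteMeasure (gaussWeight E) := ⟨by rw [gaussWeight_univ]; exact ENNReal.ofReal_lt_top⟩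

lemma gaussWeight_univ_ne_zero : gaussWeight E Set.univ ≠ 0 := by
  rw [gaussWeight_univ, Ne, ENNReal.ofReal_eq_zero, not_le]
  exact Real.rpow_pos_of_pos Real.pi_pos _

lemma ae_gaussWeight_ne_zero [Nontrivial E] : ∀ᵐ g ∂(gaussWeight E), g ≠ 0 := by
  have h : ∀ᵐ g ∂(volume : Measure E), g ≠ 0 := by
    rw [ae_iff]; simp
  exact (withDensity_absolutelyContinuous volume _).ae_le h

lemma gaussWeight_preimage {F : Type*} [NormedAddCommGroup F] [InnerProductSpace ℝ F]
    [FiniteDimensional ℝ F] [MeasurableSpace F] [BorelSpace F] (U : F ≃ₗᵢ[ℝ] E) {s : Set E}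
    (hs : MeasurableSet s) : gaussWeight F (U ⁻¹' s) = gaussWeight E s := by
  have hU : MeasurePreserving U volume volume := U.measurePreserving
  rw [gaussWeight, gaussWeight, withDensity_apply _ hs,
    withDensity_apply _ (hU.measurable hs), ← hU.setLIntegral_comp_preimage hs (by fun_prop)]
  simp

/-- The probability that a point uniformly distributed on the sphere of radius `ρ` about the origin
is at distance more than `r` from `-σ e`. -/
noncomputable def capProb (e : E) (ρ σ r : ℝ) : ENNReal :=
  gaussWeight E {g | r < ‖(ρ / ‖g‖) • g + σ • e‖} / gaussWeight E Set.univ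

lemma measurable_capProb (e : E) (ρ r : ℝ) : Measurable fun σ => capProb e ρ σ r := by
  unfold capProb
  refine Measurable.div_const ?_ _
  have hm : MeasurableSet {z : ℝ × E | r < ‖(ρ / ‖z.2‖) • z.2 + z.1 • e‖} :=
    measurableSet_lt measurable_const (by fun_prop)
  exact measurable_measure_prodMk_left hm

lemma capProb_eq_zero {e : E} (he : ‖e‖ = 1) {ρ σ r : ℝ} (hρ : 0 ≤ ρ) (hσ : 0 ≤ σ)
    (h : ρ + σ ≤ r) : capProb e ρ σ r = 0 := by
  have : {g : E | r < ‖(ρ / ‖g‖) • g + σ • e‖} = ∅ := by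
    ext g
    simp only [Set.mem_ofPred_eq, Set.mem_empty_iff_false, iff_false, not_lt]
    refine (norm_add_le _ _).trans (le_trans ?_ h)
    rw [norm_smul, norm_smul, he, mul_one, Real.norm_of_nonneg hσ, Real.norm_of_nonneg (by positivity)]
    gcongr
    rcases eq_or_ne ‖g‖ 0 with h0 | h0
    · simpa [h0] using hρ
    · rw [div_mul_cancel₀ _ h0]
  rw [capProb, this]
  simp

/-- By rotation invariance, in the probability that a spherically symmetric random vector `Y` is
far from `x`, the direction of `x` may be averaged over the sphere, so that only the norms of `x`
and `Y` matter. -/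
lemma measure_far_eq_lintegral_capProb [Nontrivial E] {ν : Measure E} [IsProbabilityMeasure ν]
    (hν : ∀ U : E ≃ₗᵢ[ℝ] E, ν.map U = ν) {e : E} (he : ‖e‖ = 1) {x : E}
    (r : ℝ) {R : Set ℝ} (hR : MeasurableSet R) :
    ν {y | ‖y‖ ∈ R ∧ r < ‖x - y‖} = ∫⁻ y in {y | ‖y‖ ∈ R}, capProb e ‖x‖ ‖y‖ r ∂ν := by
  set N : E → ENNReal := fun z => ν {y | ‖y‖ ∈ R ∧ r < ‖z - y‖} with hN
  have hRm : MeasurableSet {y : E | ‖y‖ ∈ R} := measurable_norm hR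
  have hNm : ∀ z, MeasurableSet {y : E | ‖y‖ ∈ R ∧ r < ‖z - y‖} := fun z =>
    hRm.inter (measurableSet_lt (g := fun y : E => ‖z - y‖) measurable_const (by fun_prop))
  have hNU : ∀ (U : E ≃ₗᵢ[ℝ] E) z, N (U z) = N z := by
    intro U z
    simp only [hN]
    conv_lhs => rw [← hν U]
    rw [Measure.map_apply U.continuous.measurable (hNm _)]
    congr 1
    ext y
    simp [← map_sub]
  have hNx : ∀ g : E, g ≠ 0 → N ((‖x‖ / ‖g‖) • g) = N x := by
    intro g hg
    have hg' : ‖g‖ ≠ 0 := norm_ne_zero_iff.2 hg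
    obtain ⟨U, hU⟩ := exists_linearIsometryEquiv_apply_eq (x := x) (y := (‖x‖ / ‖g‖) • g)
      (by rw [norm_smul, Real.norm_of_nonneg (by positivity), div_mul_cancel₀ _ hg'])
    rw [← hU, hNU]
  have hCm : MeasurableSet {z : E × E | ‖z.2‖ ∈ R ∧ r < ‖(‖x‖ / ‖z.1‖) • z.1 - z.2‖} :=
    (hRm.preimage measurable_snd).inter (measurableSet_lt
      (g := fun z : E × E => ‖(‖x‖ / ‖z.1‖) • z.1 - z.2‖) measurable_const (by fun_prop))
  have h1 : N x * gaussWeight E Set.univ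
      = ((gaussWeight E).prod ν) {z : E × E | ‖z.2‖ ∈ R ∧ r < ‖(‖x‖ / ‖z.1‖) • z.1 - z.2‖} := by
    rw [Measure.prod_apply hCm, ← lintegral_const]
    refine lintegral_congr_ae ?_
    filter_upwards [ae_gaussWeight_ne_zero] with g hg
    exact (hNx g hg).symm
  have h2 : ∀ y, gaussWeight E {g | r < ‖(‖x‖ / ‖g‖) • g - y‖}
      = gaussWeight E {g | r < ‖(‖x‖ / ‖g‖) • g + ‖y‖ • e‖} := by
    intro y
    obtain ⟨U, hU⟩ := exists_linearIsometryEquiv_apply_eq (x := y) (y := -(‖y‖ • e))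
      (by rw [norm_neg, norm_smul, he, norm_norm, mul_one])
    have hm : MeasurableSet {g : E | r < ‖(‖x‖ / ‖g‖) • g + ‖y‖ • e‖} :=
      measurableSet_lt measurable_const (by fun_prop)
    rw [← gaussWeight_preimage U hm]
    congr 1
    ext g
    simp only [Set.mem_ofPred_eq, Set.preimage_ofPred_eq, LinearIsometryEquiv.norm_map]
    rw [← LinearIsometryEquiv.norm_map U ((‖x‖ / ‖g‖) • g - y), map_sub, hU, map_smul,
      sub_neg_eq_add]
  rw [Measure.prod_apply_symm hCm] at h1
  have h3 : ∀ y, gaussWeight E ((fun g => (g, y)) ⁻¹'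
        {z : E × E | ‖z.2‖ ∈ R ∧ r < ‖(‖x‖ / ‖z.1‖) • z.1 - z.2‖})
      = ({y : E | ‖y‖ ∈ R}.indicator (fun y => capProb e ‖x‖ ‖y‖ r) y) * gaussWeight E Set.univ := by
    intro y
    by_cases hy : ‖y‖ ∈ R
    · rw [Set.indicator_of_mem (show y ∈ {y : E | ‖y‖ ∈ R} from hy), capProb,
        ENNReal.div_mul_cancel gaussWeight_univ_ne_zero (measure_ne_top _ _), ← h2]
      congr 1
      ext g
      simp [hy]
    · rw [Set.indicator_of_notMem (show y ∉ {y : E | ‖y‖ ∈ R} from hy), zero_mul]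
      convert! measure_empty (μ := gaussWeight E)
      ext g
      simp [hy]
  simp_rw [h3] at h1
  have hmeas : Measurable fun y : E => capProb e ‖x‖ ‖y‖ r :=
    (measurable_capProb e ‖x‖ r).comp measurable_norm
  rw [lintegral_mul_const _ (hmeas.indicator hRm), lintegral_indicator hRm] at h1
  exact (ENNReal.mul_left_inj gaussWeight_univ_ne_zero (measure_ne_top _ _)).1 h1

/-- The cone of vectors whose angle with `e` has cosine greater than `1 - h`. -/
def cone (e : E) (h : ℝ) : Set E := {g | (1 - h) * ‖g‖ < inner ℝ e g}

lemma measurableSet_cone (e : E) (h : ℝ) : MeasurableSet (cone e h) :=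
  measurableSet_lt (by fun_prop) (by fun_prop)

lemma capProb_eq_cone [Nontrivial E] {e : E} (he : ‖e‖ = 1) {ρ σ r : ℝ} (hρ : 0 < ρ) (hσ : 0 < σ)
    (hr : 0 ≤ r) :
    capProb e ρ σ r = gaussWeight E (cone e (((ρ + σ) ^ 2 - r ^ 2) / (2 * ρ * σ)))
      / gaussWeight E Set.univ := by
  rw [capProb]
  congr 1
  refine measure_congr ?_
  filter_upwards [ae_gaussWeight_ne_zero] with g hg
  refine propext ?_
  have hg' : 0 < ‖g‖ := norm_pos_iff.2 hg
  change r < ‖(ρ / ‖g‖) • g + σ • e‖ ↔ (1 - ((ρ + σ) ^ 2 - r ^ 2) / (2 * ρ * σ)) * ‖g‖ < inner ℝ e g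
  have h1 : ‖(ρ / ‖g‖) • g + σ • e‖ ^ 2 = ρ ^ 2 + σ ^ 2 + 2 * ρ * σ * (inner ℝ e g / ‖g‖) := by
    rw [norm_add_sq_real, norm_smul, norm_smul, inner_smul_left, inner_smul_right, he,
      Real.norm_of_nonneg (by positivity), Real.norm_of_nonneg hσ.le, real_inner_comm,
      div_mul_cancel₀ _ hg'.ne']
    simp only [conj_trivial]
    ring
  rw [← sq_lt_sq₀ hr (norm_nonneg _), h1, ← lt_div_iff₀ hg', sub_lt_comm, lt_div_iff₀ (by positivity)]
  constructor <;> intro h <;> nlinarith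

end Cap

/-! ### Weight of a narrow cone -/

/-- The leading constant in the asymptotics `capConst m * (2 h) ^ (m / 2)` of the uniform
probability that two directions in dimension `m + 1` have angle with cosine greater than
`1 - h`. -/
noncomputable def capConst (m : ℕ) : ℝ :=
  Real.Gamma ((m + 1) / 2) / (2 * √Real.pi * Real.Gamma (m / 2 + 1))

lemma capConst_pos (m : ℕ) : 0 < capConst m := by
  unfold capConst
  have h1 : 0 < Real.Gamma ((m + 1) / 2) := Real.Gamma_pos_of_pos (by positivity)
  have h2 : 0 < Real.Gamma (m / 2 + 1) := Real.Gamma_pos_of_pos (by positivity)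
  have := Real.pi_pos
  positivity

section Cone

variable {m : ℕ}

lemma gaussWeight_prod_apply {s : Set (WithLp 2 (ℝ × EuclideanSpace ℝ (Fin m)))}
    (hs : MeasurableSet s) :
    gaussWeight (WithLp 2 (ℝ × EuclideanSpace ℝ (Fin m))) s
      = ∫⁻ x : ℝ, ∫⁻ y : EuclideanSpace ℝ (Fin m), s.indicator
        (fun _ => ENNReal.ofReal (Real.exp (-x ^ 2)) * ENNReal.ofReal (Real.exp (-‖y‖ ^ 2)))
          (WithLp.toLp 2 (x, y)) := by
  have hpres := WithLp.volume_preserving_toLp ℝ (EuclideanSpace ℝ (Fin m))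
  have hden : Measurable fun z : WithLp 2 (ℝ × EuclideanSpace ℝ (Fin m)) =>
      ENNReal.ofReal (Real.exp (-‖z‖ ^ 2)) := by fun_prop
  rw [gaussWeight, withDensity_apply _ hs, ← lintegral_indicator hs,
    ← hpres.lintegral_comp (hden.indicator hs), Measure.volume_eq_prod, lintegral_prod]
  · refine lintegral_congr fun x => lintegral_congr fun y => ?_
    by_cases h : WithLp.toLp 2 (x, y) ∈ s
    · rw [Set.indicator_of_mem h, Set.indicator_of_mem h, ← ENNReal.ofReal_mul (by positivity),
        ← Real.exp_add, WithLp.prod_norm_sq_eq_of_L2]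
      congr 2
      simp
      ring
    · rw [Set.indicator_of_notMem h, Set.indicator_of_notMem h]
  · exact ((hden.indicator hs).comp hpres.measurable).aemeasurable

/-- The Gaussian weight of the cone `‖y‖ < τ x` in `ℝ × ℝ ^ m`. -/
noncomputable def coneWeight (m : ℕ) (τ : ℝ) : ENNReal :=
  ∫⁻ x in Set.Ioi (0 : ℝ), ∫⁻ y in Metric.ball (0 : EuclideanSpace ℝ (Fin m)) (τ * x),
    ENNReal.ofReal (Real.exp (-x ^ 2)) * ENNReal.ofReal (Real.exp (-‖y‖ ^ 2))

lemma one_sub_mul_sqrt_lt_iff {h x y : ℝ} (h1 : h < 1) (h0 : 0 < h) (hy : 0 ≤ y) :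
    (1 - h) * √(x ^ 2 + y ^ 2) < x ↔ 0 < x ∧ y < √((2 * h - h ^ 2) / (1 - h) ^ 2) * x := by
  have hh : 0 < 1 - h := by linarith
  have hnum : 0 < 2 * h - h ^ 2 := by nlinarith
  by_cases hx : 0 < x
  · simp only [hx, true_and]
    rw [← sq_lt_sq₀ (by positivity) hx.le, ← sq_lt_sq₀ hy (by positivity), mul_pow, mul_pow,
      Real.sq_sqrt (by positivity), Real.sq_sqrt (by positivity), div_mul_eq_mul_div,
      lt_div_iff₀ (by positivity)]
    constructor <;> intro h' <;> nlinarith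
  · simp only [hx, false_and, iff_false, not_lt]
    exact (not_lt.1 hx).trans (by positivity)

variable (m) in
/-- Some axis gives the cone its product form (all axes do, by rotation invariance). -/
lemma exists_unit_gaussWeight_cone :
    ∃ e : EuclideanSpace ℝ (Fin (m + 1)), ‖e‖ = 1 ∧ ∀ h : ℝ, 0 < h → h < 1 →
      gaussWeight (EuclideanSpace ℝ (Fin (m + 1))) (cone e h)
        = coneWeight m √((2 * h - h ^ 2) / (1 - h) ^ 2) := by
  have hfin : Module.finrank ℝ (WithLp 2 (ℝ × EuclideanSpace ℝ (Fin m)))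
      = m + 1 := by
    rw [(WithLp.linearEquiv 2 ℝ (ℝ × EuclideanSpace ℝ (Fin m))).finrank_eq]
    simp [add_comm]
  let φ : WithLp 2 (ℝ × EuclideanSpace ℝ (Fin m)) ≃ₗᵢ[ℝ] EuclideanSpace ℝ (Fin (m + 1)) :=
    ((stdOrthonormalBasis ℝ _).reindex (finCongr hfin)).repr
  refine ⟨φ (WithLp.toLp 2 (1, 0)), ?_, fun h h0 h1 => ?_⟩
  · rw [φ.norm_map, WithLp.prod_norm_eq_of_L2]
    simp
  set τ := √((2 * h - h ^ 2) / (1 - h) ^ 2)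
  rw [← gaussWeight_preimage φ (measurableSet_cone _ _),
    gaussWeight_prod_apply (φ.continuous.measurable (measurableSet_cone _ _)), coneWeight,
    ← lintegral_indicator measurableSet_Ioi]
  refine lintegral_congr fun x => ?_
  have hmem : ∀ y : EuclideanSpace ℝ (Fin m),
      WithLp.toLp 2 (x, y) ∈ φ ⁻¹' cone (φ (WithLp.toLp 2 (1, 0))) h
        ↔ 0 < x ∧ ‖y‖ < τ * x := by
    intro y
    rw [← one_sub_mul_sqrt_lt_iff h1 h0 (norm_nonneg y)]
    simp only [Set.mem_preimage, cone, Set.mem_ofPred_eq, φ.norm_map, φ.inner_map_map,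
      WithLp.prod_norm_eq_of_L2, WithLp.prod_inner_apply]
    simp
  by_cases hx : 0 < x
  · rw [Set.indicator_of_mem (show x ∈ Set.Ioi 0 from hx), ← lintegral_indicator measurableSet_ball]
    refine lintegral_congr fun y => ?_
    by_cases hy : ‖y‖ < τ * x
    · rw [Set.indicator_of_mem ((hmem y).2 ⟨hx, hy⟩),
        Set.indicator_of_mem (by simpa using hy)]
    · rw [Set.indicator_of_notMem (fun hcon => hy ((hmem y).1 hcon).2),
        Set.indicator_of_notMem (by simpa using hy)]
  · rw [Set.indicator_of_notMem (show x ∉ Set.Ioi 0 from hx)]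
    refine lintegral_eq_zero_of_ae_eq_zero (Eventually.of_forall fun y => ?_)
    exact Set.indicator_of_notMem (fun hcon => hx ((hmem y).1 hcon).1) _

lemma lintegral_pow_mul_exp_neg_mul_sq {b : ℝ} (hb : 0 < b) (m : ℕ) :
    ∫⁻ x in Set.Ioi (0 : ℝ), ENNReal.ofReal (x ^ m * Real.exp (-b * x ^ 2))
      = ENNReal.ofReal (b ^ (-((m : ℝ) + 1) / 2) * (1 / 2) * Real.Gamma (((m : ℝ) + 1) / 2)) := by
  have hm : (-1 : ℝ) < m := by
    have : (0 : ℝ) ≤ m := by positivity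
    linarith
  have h := integral_rpow_mul_exp_neg_mul_rpow (p := 2) (q := m) (b := b) two_pos hm hb
  have hint := integrableOn_rpow_mul_exp_neg_mul_rpow (p := 2) (s := m) (b := b) hm two_pos hb
  simp only [Real.rpow_natCast, Real.rpow_ofNat] at h hint
  rw [← h, ofReal_integral_eq_lintegral_ofReal hint]
  rw [EventuallyLE, ae_restrict_iff' measurableSet_Ioi]
  refine Eventually.of_forall fun v hv => ?_
  have hv' : (0 : ℝ) < v := hv
  simp only [Pi.zero_apply]
  positivity

lemma volume_ball_mul (hm : 1 ≤ m) {τ x : ℝ} (hτ : 0 ≤ τ) (hx : 0 ≤ x) :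
    volume (Metric.ball (0 : EuclideanSpace ℝ (Fin m)) (τ * x))
      = ENNReal.ofReal (√Real.pi ^ m / Real.Gamma (m / 2 + 1) * τ ^ m * x ^ m) := by
  have : Nonempty (Fin m) := ⟨⟨0, hm⟩⟩
  rw [EuclideanSpace.volume_ball, Fintype.card_fin, ← ENNReal.ofReal_pow (by positivity),
    ← ENNReal.ofReal_mul (by positivity)]
  congr 1
  rw [mul_pow]; ring

lemma gaussWeight_univ_euclidean (m : ℕ) :
    gaussWeight (EuclideanSpace ℝ (Fin (m + 1))) Set.univ
      = ENNReal.ofReal (√Real.pi ^ (m + 1)) := by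
  rw [gaussWeight_univ, finrank_euclideanSpace_fin, Real.sqrt_eq_rpow, ← Real.rpow_mul_natCast
    Real.pi_pos.le]
  congr 2
  ring

lemma lintegral_volume_ball_mul_exp (hm : 1 ≤ m) {τ b : ℝ} (hτ : 0 ≤ τ) (hb : 0 < b) :
    ∫⁻ x in Set.Ioi (0 : ℝ), ENNReal.ofReal (√Real.pi ^ m / Real.Gamma (m / 2 + 1) * τ ^ m * x ^ m)
        * ENNReal.ofReal (Real.exp (-b * x ^ 2))
      = ENNReal.ofReal (capConst m * τ ^ m * b ^ (-((m : ℝ) + 1) / 2)) *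
          gaussWeight (EuclideanSpace ℝ (Fin (m + 1))) Set.univ := by
  have hG : 0 < Real.Gamma (m / 2 + 1) := Real.Gamma_pos_of_pos (by positivity)
  have hpi := Real.pi_pos
  have hc := capConst_pos m
  calc _ = ∫⁻ x in Set.Ioi (0 : ℝ),
        ENNReal.ofReal (√Real.pi ^ m / Real.Gamma (m / 2 + 1) * τ ^ m) *
        ENNReal.ofReal (x ^ m * Real.exp (-b * x ^ 2)) := by
        refine setLIntegral_congr_fun measurableSet_Ioi fun x hx => ?_
        have hx' : (0 : ℝ) < x := hx
        rw [← ENNReal.ofReal_mul (by positivity), ← ENNReal.ofReal_mul (by positivity)]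
        congr 1; ring
    _ = _ := by
        rw [lintegral_const_mul _ (by fun_prop), lintegral_pow_mul_exp_neg_mul_sq hb,
          gaussWeight_univ_euclidean, ← ENNReal.ofReal_mul (by positivity),
          ← ENNReal.ofReal_mul (by positivity)]
        congr 1
        rw [capConst]
        have : √Real.pi ≠ 0 := by positivity
        field_simp
        ring

/-- Upper bound for the weight of a narrow cone, by dropping the factor `exp (-‖y‖ ^ 2) ≤ 1`. -/
lemma coneWeight_le (hm : 1 ≤ m) {τ : ℝ} (hτ : 0 ≤ τ) :
    coneWeight m τ ≤ ENNReal.ofReal (capConst m * τ ^ m) *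
      gaussWeight (EuclideanSpace ℝ (Fin (m + 1))) Set.univ := by
  have h := lintegral_volume_ball_mul_exp hm hτ one_pos
  rw [Real.one_rpow, mul_one] at h
  rw [← h, coneWeight]
  refine setLIntegral_mono' measurableSet_Ioi fun x hx => ?_
  have hx' : (0 : ℝ) < x := hx
  rw [← volume_ball_mul hm hτ hx'.le, neg_one_mul, mul_comm (volume _), ← setLIntegral_const]
  refine lintegral_mono fun y => ?_
  refine mul_le_of_le_one_right zero_le ?_
  rw [ENNReal.ofReal_le_one, Real.exp_le_one_iff]
  nlinarith [sq_nonneg ‖y‖]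

/-- Lower bound for the weight of a narrow cone, from `exp (-‖y‖ ^ 2) ≥ exp (-(τ x) ^ 2)`. -/
lemma le_coneWeight (hm : 1 ≤ m) {τ : ℝ} (hτ : 0 ≤ τ) :
    ENNReal.ofReal (capConst m * τ ^ m * (1 + τ ^ 2) ^ (-((m : ℝ) + 1) / 2)) *
      gaussWeight (EuclideanSpace ℝ (Fin (m + 1))) Set.univ ≤ coneWeight m τ := by
  have hb : 0 < 1 + τ ^ 2 := by positivity
  rw [← lintegral_volume_ball_mul_exp hm hτ hb, coneWeight]
  refine setLIntegral_mono' measurableSet_Ioi fun x hx => ?_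
  have hx' : (0 : ℝ) < x := hx
  rw [← volume_ball_mul hm hτ hx'.le, mul_comm (volume _), ← setLIntegral_const]
  refine setLIntegral_mono' measurableSet_ball fun y hy => ?_
  rw [← ENNReal.ofReal_mul (Real.exp_pos _).le, ← Real.exp_add]
  refine ENNReal.ofReal_le_ofReal (Real.exp_le_exp.2 ?_)
  have hy' : ‖y‖ < τ * x := by simpa using hy
  have : ‖y‖ ^ 2 ≤ (τ * x) ^ 2 := by gcongr
  nlinarith

end Cone

/-- Uniform asymptotics of the cap probability for two radii close to `a` and a distance close to
`2 a`: to first order, the radii `a (1 + x)`, `a (1 + y)` and the distance `a (2 - z)` give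
`capConst m * (4 (x + y + z)₊) ^ (m / 2)`. -/
lemma exists_unit_capProb_bounds {m : ℕ} (hm : 1 ≤ m) :
    ∃ e : EuclideanSpace ℝ (Fin (m + 1)), ‖e‖ = 1 ∧ ∀ ε : ℝ, 0 < ε → ∃ δ > 0,
      ∀ x y z a : ℝ, |x| < δ → |y| < δ → |z| < δ → 0 < a →
      ENNReal.ofReal ((1 - ε) * (capConst m * (4 * max (z + x + y) 0) ^ (m / 2 : ℝ)))
          ≤ capProb e (a * (1 + x)) (a * (1 + y)) (a * (2 - z)) ∧
        capProb e (a * (1 + x)) (a * (1 + y)) (a * (2 - z))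
          ≤ ENNReal.ofReal ((1 + ε) * (capConst m * (4 * max (z + x + y) 0) ^ (m / 2 : ℝ))) := by
  obtain ⟨e, he, hcone⟩ := exists_unit_gaussWeight_cone m
  refine ⟨e, he, fun ε hε => ?_⟩
  have hm0 : (0 : ℝ) < m / 2 := by
    have : (1 : ℝ) ≤ m := by exact_mod_cast hm
    linarith
  -- the height of the cap, and the ratio of the squared slope of the cone to `4 (x + y + z)`
  let H : ℝ × ℝ × ℝ → ℝ := fun v =>
    (v.1 + v.2.1 + v.2.2) * (4 + v.1 + v.2.1 - v.2.2) / (2 * (1 + v.1) * (1 + v.2.1))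
  let Ψ : ℝ × ℝ × ℝ → ℝ := fun v =>
    (4 + v.1 + v.2.1 - v.2.2) / (4 * (1 + v.1) * (1 + v.2.1)) * ((1 - H v / 2) / (1 - H v) ^ 2)
  let G : ℝ × ℝ × ℝ → ℝ := fun v => Ψ v ^ (m / 2 : ℝ) *
    (1 + 4 * (v.1 + v.2.1 + v.2.2) * Ψ v) ^ (-((m : ℝ) + 1) / 2)
  have hH0 : H 0 = 0 := by simp [H]
  have hΨ0 : Ψ 0 = 1 := by
    simp only [Ψ, hH0]; simp
  have hHc : ContinuousAt H 0 := by
    refine ContinuousAt.div (by fun_prop) (by fun_prop) (by simp)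
  have hΨc : ContinuousAt Ψ 0 := by
    refine ContinuousAt.mul (ContinuousAt.div (by fun_prop) (by fun_prop) (by simp))
      (ContinuousAt.div (by fun_prop) (by fun_prop) (by simp [hH0]))
  have hΨpc : ContinuousAt (fun v => Ψ v ^ (m / 2 : ℝ)) 0 :=
    hΨc.rpow_const (Or.inl (by simp [hΨ0]))
  have hGc : ContinuousAt G 0 := by
    refine hΨpc.mul (ContinuousAt.rpow_const (by fun_prop) (Or.inl (by simp)))
  have hG0 : G 0 = 1 := by simp [G, hΨ0]
  have ev1 : ∀ᶠ v in 𝓝 (0 : ℝ × ℝ × ℝ), Ψ v ^ (m / 2 : ℝ) < 1 + ε :=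
    hΨpc.eventually (gt_mem_nhds (by simp [hΨ0, hε]))
  have ev2 : ∀ᶠ v in 𝓝 (0 : ℝ × ℝ × ℝ), 1 - ε < G v :=
    hGc.eventually (lt_mem_nhds (by simp [hG0, hε]))
  have ev3 : ∀ᶠ v in 𝓝 (0 : ℝ × ℝ × ℝ), H v < 1 :=
    hHc.eventually (gt_mem_nhds (by simp [hH0]))
  have ev4 : ∀ᶠ v in 𝓝 (0 : ℝ × ℝ × ℝ), 0 < Ψ v :=
    hΨc.eventually (lt_mem_nhds (by simp [hΨ0]))
  obtain ⟨δ, hδ, hball⟩ := Metric.eventually_nhds_iff.1 (((ev1.and ev2).and ev3).and ev4)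
  refine ⟨min δ 1, by positivity, fun x y z a hx hy hz ha => ?_⟩
  have hdist : dist (x, y, z) (0 : ℝ × ℝ × ℝ) < δ := by
    simp only [Prod.dist_eq, Prod.fst_zero, Prod.snd_zero, Real.dist_eq, sub_zero]
    exact max_lt (hx.trans_le (min_le_left _ _)) (max_lt (hy.trans_le (min_le_left _ _))
      (hz.trans_le (min_le_left _ _)))
  obtain ⟨⟨⟨h1, h2⟩, h3⟩, h4⟩ := hball hdist
  have hx1 := abs_lt.1 (hx.trans_le (min_le_right _ _))
  have hy1 := abs_lt.1 (hy.trans_le (min_le_right _ _))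
  have hz1 := abs_lt.1 (hz.trans_le (min_le_right _ _))
  have hρ : 0 < a * (1 + x) := mul_pos ha (by linarith)
  have hσ : 0 < a * (1 + y) := mul_pos ha (by linarith)
  have hr : 0 < a * (2 - z) := mul_pos ha (by linarith)
  rcases le_or_gt (z + x + y) 0 with hu | hu
  · rw [max_eq_right hu, mul_zero, Real.zero_rpow hm0.ne', mul_zero, mul_zero, mul_zero,
      ENNReal.ofReal_zero, capProb_eq_zero he hρ.le hσ.le]
    · simp
    · nlinarith
  rw [max_eq_left hu.le, capProb_eq_cone he hρ hσ hr.le]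
  have hHeq : ((a * (1 + x) + a * (1 + y)) ^ 2 - (a * (2 - z)) ^ 2)
      / (2 * (a * (1 + x)) * (a * (1 + y))) = H (x, y, z) := by
    have hx2 : (1 + x) ≠ 0 := by linarith
    have hy2 : (1 + y) ≠ 0 := by linarith
    simp only [H]
    field_simp
    ring
  have hHpos : 0 < H (x, y, z) := by
    simp only [H]
    have e1 : 0 < x + y + z := by linarith
    have e2 : 0 < 4 + x + y - z := by linarith
    have e3 : 0 < 1 + x := by linarith
    have e4 : 0 < 1 + y := by linarith
    positivity
  rw [hHeq, hcone _ hHpos h3]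
  set τ := √((2 * H (x, y, z) - H (x, y, z) ^ 2) / (1 - H (x, y, z)) ^ 2) with hτ
  have hτsq : (2 * H (x, y, z) - H (x, y, z) ^ 2) / (1 - H (x, y, z)) ^ 2
      = 4 * (z + x + y) * Ψ (x, y, z) := by
    have e5 : 2 * H (x, y, z) = 4 * (z + x + y) *
        ((4 + x + y - z) / (4 * (1 + x) * (1 + y))) := by
      have hx2 : (1 + x) ≠ 0 := by linarith
      have hy2 : (1 + y) ≠ 0 := by linarith
      simp only [H]
      field_simp
      ring
    calc _ = 2 * H (x, y, z) * ((1 - H (x, y, z) / 2) / (1 - H (x, y, z)) ^ 2) := by ring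
      _ = _ := by rw [e5]; simp only [Ψ]; ring
  have hτ2 : τ ^ 2 = 4 * (z + x + y) * Ψ (x, y, z) := by
    rw [hτ, Real.sq_sqrt, hτsq]
    rw [hτsq]; positivity
  have hτm : τ ^ m = (4 * (z + x + y)) ^ (m / 2 : ℝ) * Ψ (x, y, z) ^ (m / 2 : ℝ) := by
    rw [hτ, hτsq, Real.sqrt_eq_rpow, ← Real.rpow_mul_natCast (by positivity),
      ← Real.mul_rpow (by positivity) h4.le]
    congr 1
    ring
  have hc := capConst_pos m
  have hγ := gaussWeight_univ_ne_zero (E := EuclideanSpace ℝ (Fin (m + 1)))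
  have hγ' := measure_ne_top (gaussWeight (EuclideanSpace ℝ (Fin (m + 1)))) Set.univ
  constructor
  · rw [ENNReal.le_div_iff_mul_le (Or.inl hγ) (Or.inl hγ')]
    refine le_trans ?_ (le_coneWeight hm (Real.sqrt_nonneg _))
    gcongr ENNReal.ofReal ?_ * _
    rw [hτ2, hτm]
    have : capConst m * ((4 * (z + x + y)) ^ (m / 2 : ℝ) * Ψ (x, y, z) ^ (m / 2 : ℝ)) *
        (1 + 4 * (z + x + y) * Ψ (x, y, z)) ^ (-((m : ℝ) + 1) / 2)
        = G (x, y, z) * (capConst m * (4 * (z + x + y)) ^ (m / 2 : ℝ)) := by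
      simp only [G]
      rw [show z + x + y = x + y + z by ring]
      ring
    rw [this]
    gcongr
  · rw [ENNReal.div_le_iff hγ hγ']
    refine (coneWeight_le hm (Real.sqrt_nonneg _)).trans ?_
    gcongr ENNReal.ofReal ?_ * _
    rw [hτm]
    calc _ = Ψ (x, y, z) ^ (m / 2 : ℝ) * (capConst m * (4 * (z + x + y)) ^ (m / 2 : ℝ)) := by ring
      _ ≤ _ := by gcongr

/-! ### The probability that two truncated points are far apart -/

section FarPairs

variable {E : Type*} [NormedAddCommGroup E]

/-- Pairs of points at distance more than `2 a - b r` whose norms do not exceed `a + b A`. -/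
def farPairs (E : Type*) [NormedAddCommGroup E] (a b A r : ℝ) : Set (E × E) :=
  {z | 2 * a - b * r < ‖z.1 - z.2‖ ∧ ‖z.1‖ ≤ a + b * A ∧ ‖z.2‖ ≤ a + b * A}

lemma farPairs_symm {a b A r : ℝ} (x y : E) (h : (x, y) ∈ farPairs E a b A r) :
    (y, x) ∈ farPairs E a b A r :=
  ⟨by rw [norm_sub_rev]; exact h.1, h.2.2, h.2.1⟩

variable [MeasurableSpace E]

lemma measurableSet_farPairs [BorelSpace E] [SecondCountableTopology E] (a b A r : ℝ) :
    MeasurableSet (farPairs E a b A r) :=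
  (measurableSet_lt (g := fun z : E × E => ‖z.1 - z.2‖) measurable_const (by fun_prop)).inter
    ((measurableSet_le (f := fun z : E × E => ‖z.1‖) (by fun_prop) measurable_const).inter
      (measurableSet_le (f := fun z : E × E => ‖z.2‖) (by fun_prop) measurable_const))

/-- The law of the rescaled radius `(|x| - a) / b`, restricted to radii at most `a + b A`. -/
noncomputable def radialMeasure (ν : Measure E) (a b A : ℝ) : Measure ℝ :=
  (ν.restrict {x | ‖x‖ ≤ a + b * A}).map fun x => (‖x‖ - a) / b

variable [OpensMeasurableSpace E]

lemma lintegral_radialMeasure (ν : Measure E) (a b A : ℝ) {f : ℝ → ENNReal} (hf : Measurable f) :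
    ∫⁻ t, f t ∂(radialMeasure ν a b A)
      = ∫⁻ x in {x | ‖x‖ ≤ a + b * A}, f ((‖x‖ - a) / b) ∂ν :=
  lintegral_map hf (by fun_prop)

lemma radialMeasure_Ioi (ν : Measure E) {a b : ℝ} (hb : 0 < b) (A t : ℝ) :
    radialMeasure ν a b A (Set.Ioi t) = ν ({x | a + t * b < ‖x‖} \ {x | a + A * b < ‖x‖}) := by
  rw [radialMeasure, Measure.map_apply (by fun_prop) measurableSet_Ioi, Measure.restrict_apply
    (measurableSet_Ioi.preimage (by fun_prop))]
  congr 1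
  ext x
  simp only [Set.mem_inter_iff, Set.mem_preimage, Set.mem_Ioi, Set.mem_ofPred_eq, Set.mem_sdiff,
    not_lt, lt_div_iff₀ hb, mul_comm b A]
  constructor <;> rintro ⟨h1, h2⟩ <;> exact ⟨by linarith, h2⟩

lemma radialMeasure_Ioi_self (ν : Measure E) {a b : ℝ} (hb : 0 < b) (A : ℝ) :
    radialMeasure ν a b A (Set.Ioi A) = 0 := by
  rw [radialMeasure_Ioi ν hb]; simp

lemma radialMeasure_Ioi_le (ν : Measure E) [IsProbabilityMeasure ν] {a b A T c : ℝ} (hb : 0 < b)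
    (hAT : A ≤ T)
    (h : ∀ t, |t| ≤ T → ν.real {x | a + t * b < ‖x‖} ≤ c * Real.exp (-t)) (t : ℝ) (ht : -T ≤ t) :
    radialMeasure ν a b A (Set.Ioi t) ≤ ENNReal.ofReal (c * Real.exp (-t)) := by
  rcases le_or_gt t T with h1 | h1
  · rw [radialMeasure_Ioi ν hb]
    refine (measure_mono Set.sdiff_subset).trans ?_
    rw [← ofReal_measureReal (measure_ne_top _ _)]
    exact ENNReal.ofReal_le_ofReal (h t (abs_le.2 ⟨ht, h1⟩))
  · rw [measure_mono_null (Set.Ioi_subset_Ioi (hAT.trans h1.le)) (radialMeasure_Ioi_self ν hb A)]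
    exact zero_le

lemma le_radialMeasure_Ioi (ν : Measure E) [IsProbabilityMeasure ν] {a b A T c C c' M : ℝ}
    (hb : 0 < b) (hMT : M ≤ T)
    (h : ∀ t, |t| ≤ T → c * Real.exp (-t) ≤ ν.real {x | a + t * b < ‖x‖})
    (h' : ν.real {x | a + A * b < ‖x‖} ≤ C)
    (hcC : c' * Real.exp (-M) + C ≤ c * Real.exp (-M)) (hC : 0 ≤ C)
    (t : ℝ) (ht : -T ≤ t) (htM : t ≤ M) :
    ENNReal.ofReal (c' * Real.exp (-t)) ≤ radialMeasure ν a b A (Set.Ioi t) := by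
  rw [radialMeasure_Ioi ν hb, ← ofReal_measureReal (measure_ne_top _ _)]
  refine ENNReal.ofReal_le_ofReal ?_
  have h1 := h t (abs_le.2 ⟨ht, htM.trans hMT⟩)
  have h2 : ν.real {x | a + t * b < ‖x‖} - ν.real {x | a + A * b < ‖x‖}
      ≤ ν.real ({x | a + t * b < ‖x‖} \ {x | a + A * b < ‖x‖}) := by
    have := measureReal_mono (μ := ν) (s₁ := {x | a + t * b < ‖x‖})
      (s₂ := ({x | a + t * b < ‖x‖} \ {x | a + A * b < ‖x‖}) ∪ {x | a + A * b < ‖x‖})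
      (fun x hx => by by_cases hx' : a + A * b < ‖x‖ <;> simp_all)
    have := measureReal_union_le (μ := ν)
      ({x | a + t * b < ‖x‖} \ {x | a + A * b < ‖x‖}) {x | a + A * b < ‖x‖}
    linarith
  have hexp : Real.exp (-M) ≤ Real.exp (-t) := Real.exp_le_exp.2 (by linarith)
  have hpos := Real.exp_pos (-M)
  have hcc : 0 ≤ c - c' := by
    by_contra hcon
    nlinarith
  nlinarith

end FarPairs

/-- The cap asymptotics in terms of the rescaled radii `s = (ρ - a) / b` and `t = (σ - a) / b`. -/
lemma exists_unit_capProb_bounds_rescaled {m : ℕ} (hm : 1 ≤ m) :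
    ∃ e : EuclideanSpace ℝ (Fin (m + 1)), ‖e‖ = 1 ∧ ∀ ε : ℝ, 0 < ε → ∃ δ > 0,
      ∀ a b A T r ρ σ : ℝ, 0 < a → 0 < b → b * T < δ * a → A ≤ T → |r| ≤ T → r + A ≤ T →
      0 ≤ ρ → 0 ≤ σ → ρ ≤ a + b * A → σ ≤ a + b * A →
      ENNReal.ofReal ((1 - ε) * (capConst m * (4 * (b / a)) ^ (m / 2 : ℝ))) *
            ENNReal.ofReal (max (r + (ρ - a) / b + (σ - a) / b) 0 ^ (m / 2 : ℝ))
          ≤ capProb e ρ σ (2 * a - b * r) ∧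
        capProb e ρ σ (2 * a - b * r)
          ≤ ENNReal.ofReal ((1 + ε) * (capConst m * (4 * (b / a)) ^ (m / 2 : ℝ))) *
            ENNReal.ofReal (max (r + (ρ - a) / b + (σ - a) / b) 0 ^ (m / 2 : ℝ)) := by
  obtain ⟨e, he, hcap⟩ := exists_unit_capProb_bounds hm
  refine ⟨e, he, fun ε hε => ?_⟩
  obtain ⟨δ, hδ, hcap⟩ := hcap ε hε
  refine ⟨δ, hδ, fun a b A T r ρ σ ha hb hT hAT hr hrA hρ0 hσ0 hρ hσ => ?_⟩
  have hm0 : (0 : ℝ) < m / 2 := by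
    have : (1 : ℝ) ≤ m := by exact_mod_cast hm
    linarith
  obtain ⟨s, rfl⟩ : ∃ s, ρ = a + b * s := ⟨(ρ - a) / b, by field_simp; ring⟩
  obtain ⟨t, rfl⟩ : ∃ t, σ = a + b * t := ⟨(σ - a) / b, by field_simp; ring⟩
  have hsA : s ≤ A := by
    have : b * s ≤ b * A := by linarith
    exact le_of_mul_le_mul_left this hb
  have htA : t ≤ A := by
    have : b * t ≤ b * A := by linarith
    exact le_of_mul_le_mul_left this hb
  rw [add_sub_cancel_left, add_sub_cancel_left, mul_div_cancel_left₀ _ hb.ne',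
    mul_div_cancel_left₀ _ hb.ne']
  rcases le_or_gt (r + s + t) 0 with hu | hu
  · rw [max_eq_right hu, Real.zero_rpow hm0.ne', ENNReal.ofReal_zero, mul_zero, mul_zero,
      capProb_eq_zero he hρ0 hσ0]
    · simp
    · nlinarith
  have hsmall : ∀ u, |u| ≤ T → |b / a * u| < δ := by
    intro u hu
    rw [abs_mul, abs_of_pos (by positivity), div_mul_eq_mul_div, div_lt_iff₀ ha]
    exact (mul_le_mul_of_nonneg_left hu hb.le).trans_lt hT
  have hs : |s| ≤ T := abs_le.2 ⟨by linarith, by linarith⟩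
  have ht : |t| ≤ T := abs_le.2 ⟨by linarith, by linarith⟩
  have key := hcap (b / a * s) (b / a * t) (b / a * r) a (hsmall s hs) (hsmall t ht) (hsmall r hr) ha
  rw [show a * (1 + b / a * s) = a + b * s by field_simp,
    show a * (1 + b / a * t) = a + b * t by field_simp,
    show a * (2 - b / a * r) = 2 * a - b * r by field_simp] at key
  have hmax : (4 * max (b / a * r + b / a * s + b / a * t) 0) ^ (m / 2 : ℝ)
      = (4 * (b / a)) ^ (m / 2 : ℝ) * max (r + s + t) 0 ^ (m / 2 : ℝ) := by
    rw [← Real.mul_rpow (by positivity) (le_max_right _ _), max_eq_left hu.le, max_eq_left]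
    · congr 1; ring
    · have : 0 < b / a * (r + s + t) := by positivity
      linarith
  rw [hmax] at key
  have hmx : 0 ≤ max (r + s + t) 0 ^ (m / 2 : ℝ) := Real.rpow_nonneg (le_max_right _ _) _
  rw [← ENNReal.ofReal_mul' hmx, ← ENNReal.ofReal_mul' hmx]
  convert! key using 3 <;> ring

section Symmetric

variable {m : ℕ}

/-- Bounds, for fixed `a`, `b` and a fixed error `ε` of the cap asymptotics, on the measure of a
section of `farPairs`, and on the probability of `farPairs`, in terms of integrals of
`(r + s + t)₊ ^ (m / 2)` against the radial measure. -/
lemma exists_farPairs_bounds (hm : 1 ≤ m) (ε : ℝ) (hε : 0 < ε) : ∃ δ > 0,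
    ∀ (ν : Measure (EuclideanSpace ℝ (Fin (m + 1)))) [IsProbabilityMeasure ν],
      IsSphericallySymmetric ν →
    ∀ a b A T r : ℝ, 0 < a → 0 < b → b * T < δ * a → A ≤ T → |r| ≤ T → r + A ≤ T →
      (∀ x, ‖x‖ ≤ a + b * A → ν {y | (x, y) ∈ farPairs _ a b A r}
        ≤ ENNReal.ofReal ((1 + ε) * (capConst m * (4 * (b / a)) ^ (m / 2 : ℝ))) *
          ∫⁻ t, ENNReal.ofReal (max (r + (‖x‖ - a) / b + t) 0 ^ (m / 2 : ℝ))
            ∂(radialMeasure ν a b A)) ∧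
      (ν.prod ν) (farPairs _ a b A r)
        ≤ ENNReal.ofReal ((1 + ε) * (capConst m * (4 * (b / a)) ^ (m / 2 : ℝ))) *
          ∫⁻ s, ∫⁻ t, ENNReal.ofReal (max (r + s + t) 0 ^ (m / 2 : ℝ))
            ∂(radialMeasure ν a b A) ∂(radialMeasure ν a b A) ∧
      ENNReal.ofReal ((1 - ε) * (capConst m * (4 * (b / a)) ^ (m / 2 : ℝ))) *
          ∫⁻ s, ∫⁻ t, ENNReal.ofReal (max (r + s + t) 0 ^ (m / 2 : ℝ))
            ∂(radialMeasure ν a b A) ∂(radialMeasure ν a b A)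
        ≤ (ν.prod ν) (farPairs _ a b A r) := by
  set E := EuclideanSpace ℝ (Fin (m + 1))
  obtain ⟨e, he, hcap⟩ := exists_unit_capProb_bounds_rescaled hm
  obtain ⟨δ, hδ, hcap⟩ := hcap ε hε
  refine ⟨δ, hδ, fun ν _ hν a b A T r ha hb hT hAT hr hrA => ?_⟩
  set R : Set E := {x | ‖x‖ ≤ a + b * A} with hR
  have hRm : MeasurableSet R := measurableSet_le (by fun_prop) (by fun_prop)
  have hBm : MeasurableSet (farPairs E a b A r) := measurableSet_farPairs a b A r
  have hsec : ∀ x ∈ R, ν {y | (x, y) ∈ farPairs E a b A r}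
      = ∫⁻ y in R, capProb e ‖x‖ ‖y‖ (2 * a - b * r) ∂ν := by
    intro x hx
    have := measure_far_eq_lintegral_capProb hν he (x := x) (2 * a - b * r)
      (R := Set.Iic (a + b * A)) measurableSet_Iic
    rw [show {y : E | ‖y‖ ∈ Set.Iic (a + b * A)} = R from rfl] at this
    rw [← this]
    congr 1
    ext y
    constructor
    · rintro ⟨h1, _, h3⟩
      exact ⟨h3, h1⟩
    · rintro ⟨h1, h2⟩
      exact ⟨h2, hx, h1⟩
  have hsec0 : ∀ x ∉ R, ν {y | (x, y) ∈ farPairs E a b A r} = 0 := by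
    intro x hx
    convert! measure_empty (μ := ν)
    ext y
    simp only [Set.mem_ofPred_eq, Set.mem_empty_iff_false, iff_false]
    exact fun h => hx h.2.1
  set ψ : ℝ → ℝ → ENNReal := fun s t => ENNReal.ofReal (max (r + s + t) 0 ^ (m / 2 : ℝ)) with hψ
  have hψm : Measurable (Function.uncurry ψ) := by
    simp only [hψ, Function.uncurry_def]; fun_prop
  have hin : ∀ s, ∫⁻ t, ψ s t ∂(radialMeasure ν a b A) = ∫⁻ y in R, ψ s ((‖y‖ - a) / b) ∂ν :=
    fun s => lintegral_radialMeasure ν a b A (hψm.of_uncurry_left)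
  have hmap : IsFiniteMeasure (radialMeasure ν a b A) := by
    unfold radialMeasure; infer_instance
  have hout : ∫⁻ s, ∫⁻ t, ψ s t ∂(radialMeasure ν a b A) ∂(radialMeasure ν a b A)
      = ∫⁻ x in R, ∫⁻ y in R, ψ ((‖x‖ - a) / b) ((‖y‖ - a) / b) ∂ν ∂ν := by
    have hm : Measurable fun s => ∫⁻ t, ψ s t ∂(radialMeasure ν a b A) :=
      hψm.lintegral_prod_right'
    rw [lintegral_radialMeasure ν a b A hm]
    simp_rw [hin]
    rfl
  have hmeas_in : ∀ x : E, Measurable fun y : E => ψ ((‖x‖ - a) / b) ((‖y‖ - a) / b) := fun x => by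
    simp only [hψ]; fun_prop
  have hmeas_out : Measurable fun x : E => ∫⁻ y in R, ψ ((‖x‖ - a) / b) ((‖y‖ - a) / b) ∂ν := by
    refine Measurable.lintegral_prod_right' (f := fun z : E × E =>
      ψ ((‖z.1‖ - a) / b) ((‖z.2‖ - a) / b)) ?_
    simp only [hψ]; fun_prop
  have hup : ∀ x ∈ R, ν {y | (x, y) ∈ farPairs E a b A r}
      ≤ ENNReal.ofReal ((1 + ε) * (capConst m * (4 * (b / a)) ^ (m / 2 : ℝ))) *
        ∫⁻ y in R, ψ ((‖x‖ - a) / b) ((‖y‖ - a) / b) ∂ν := by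
    intro x hx
    rw [hsec x hx, ← lintegral_const_mul _ (hmeas_in x)]
    refine setLIntegral_mono' hRm fun y hy => ?_
    exact (hcap a b A T r ‖x‖ ‖y‖ ha hb hT hAT hr hrA (norm_nonneg _) (norm_nonneg _) hx hy).2
  have hlow : ∀ x ∈ R,
      ENNReal.ofReal ((1 - ε) * (capConst m * (4 * (b / a)) ^ (m / 2 : ℝ))) *
        ∫⁻ y in R, ψ ((‖x‖ - a) / b) ((‖y‖ - a) / b) ∂ν ≤ ν {y | (x, y) ∈ farPairs E a b A r} := by
    intro x hx
    rw [hsec x hx, ← lintegral_const_mul _ (hmeas_in x)]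
    refine setLIntegral_mono' hRm fun y hy => ?_
    exact (hcap a b A T r ‖x‖ ‖y‖ ha hb hT hAT hr hrA (norm_nonneg _) (norm_nonneg _) hx hy).1
  have hprod : (ν.prod ν) (farPairs E a b A r)
      = ∫⁻ x in R, ν {y | (x, y) ∈ farPairs E a b A r} ∂ν := by
    rw [Measure.prod_apply hBm, ← lintegral_indicator hRm]
    refine lintegral_congr fun x => ?_
    by_cases hx : x ∈ R
    · rw [Set.indicator_of_mem hx]; rfl
    · rw [Set.indicator_of_notMem hx]; exact hsec0 x hx
  refine ⟨fun x hx => ?_, ?_, ?_⟩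
  · rw [hin]
    exact hup x hx
  · rw [hout, hprod, ← lintegral_const_mul _ hmeas_out]
    exact setLIntegral_mono' hRm hup
  · rw [hout, hprod, ← lintegral_const_mul _ hmeas_out]
    exact setLIntegral_mono' hRm hlow

end Symmetric

/-! ### Asymptotics of the mean number of distant pairs -/

/-- The normalization `r = p L - log L - κ` as a function of `L = log (a / b)`. -/
noncomputable def distOffset (p κ L : ℝ) : ℝ := p * L - Real.log L - κ

/-- The truncation level for the rescaled radii. It tends to infinity, but slowly enough that
`exp` of it is negligible compared with `L`. -/
noncomputable def truncLevel (L : ℝ) : ℝ := Real.log L / 2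

lemma tendsto_truncLevel : Tendsto truncLevel atTop atTop :=
  Real.tendsto_log_atTop.atTop_div_const two_pos

lemma tendsto_log_div_self : Tendsto (fun L : ℝ => Real.log L / L) atTop (𝓝 0) :=
  Real.isLittleO_log_id_atTop.tendsto_div_nhds_zero

lemma tendsto_distOffset_div (p κ : ℝ) :
    Tendsto (fun L => distOffset p κ L / L) atTop (𝓝 p) := by
  have h : Tendsto (fun L : ℝ => p - Real.log L / L - κ / L) atTop (𝓝 (p - 0 - 0)) :=
    (tendsto_const_nhds.sub tendsto_log_div_self).sub (tendsto_const_nhds.div_atTop tendsto_id)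
  rw [sub_zero, sub_zero] at h
  refine h.congr' ?_
  filter_upwards [eventually_gt_atTop 0] with L hL
  rw [distOffset]
  field_simp

lemma tendsto_truncLevel_add_distOffset_div (p κ : ℝ) :
    Tendsto (fun L => (2 * truncLevel L + distOffset p κ L + 1) / L) atTop (𝓝 p) := by
  have h : Tendsto (fun L : ℝ => Real.log L / L + distOffset p κ L / L + 1 / L) atTop
      (𝓝 (0 + p + 0)) :=
    (tendsto_log_div_self.add (tendsto_distOffset_div p κ)).add
      (tendsto_const_nhds.div_atTop tendsto_id)
  rw [zero_add, add_zero] at h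
  refine h.congr fun L => ?_
  rw [truncLevel]
  ring

lemma eventually_offset_bounds {p : ℝ} (hp : 0 < p) (κ : ℝ) : ∀ᶠ L : ℝ in atTop,
    0 < L ∧ 0 ≤ truncLevel L ∧ truncLevel L ≤ p * L ∧ |distOffset p κ L| ≤ p * L ∧
      distOffset p κ L + truncLevel L ≤ p * L ∧ 0 ≤ distOffset p κ L := by
  have h1 := tendsto_log_div_self.eventually (gt_mem_nhds (show (0 : ℝ) < p / 2 by positivity))
  have h2 := Real.tendsto_log_atTop.eventually_ge_atTop (2 * |κ|)
  filter_upwards [h1, h2, eventually_gt_atTop 0, eventually_ge_atTop (2 * |κ| / p)]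
    with L h1 h2 h3 h4
  rw [div_lt_iff₀ h3] at h1
  rw [div_le_iff₀ hp] at h4
  have h5 := abs_nonneg κ
  have h6 := neg_abs_le κ
  have h7 := le_abs_self κ
  have h8 : 0 < p * L := by positivity
  simp only [truncLevel, distOffset]
  refine ⟨h3, by linarith, by linarith, abs_le.2 ⟨by linarith, by linarith⟩, by linarith,
    by nlinarith⟩

/-- The constant `maxDistConst` is chosen so that the mean number of distant pairs tends to
`exp (-l)`: the three factors are the cap constant, the Gamma integral, and the length of the
range of the rescaled radius. -/
lemma capConst_mul_eq {m : ℕ} (hm : 1 ≤ m) (l : ℝ) :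
    capConst m * 4 ^ (m / 2 : ℝ) * Real.exp (-(Real.log (maxDistConst (m + 1)) + l)) *
      Real.Gamma (m / 2 + 1) * (m / 2) = 2 * Real.exp (-l) := by
  have hm0 : (0 : ℝ) < m := by exact_mod_cast hm
  have hG1 : 0 < Real.Gamma ((m + 1) / 2) := Real.Gamma_pos_of_pos (by positivity)
  have hG2 : 0 < Real.Gamma (m / 2 + 1) := Real.Gamma_pos_of_pos (by positivity)
  have hpi : 0 < √Real.pi := Real.sqrt_pos.2 Real.pi_pos
  have h4 : (4 : ℝ) ^ (m / 2 : ℝ) = 2 ^ m := by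
    rw [show (4 : ℝ) = 2 ^ (2 : ℝ) by norm_num, ← Real.rpow_mul (by norm_num),
      show (2 : ℝ) * (m / 2) = m by ring, Real.rpow_natCast]
  have hc : maxDistConst (m + 1) = m * 2 ^ m / 8 * Real.Gamma ((m + 1) / 2) / √Real.pi := by
    rw [maxDistConst]
    push_cast
    rw [add_sub_cancel_right, show (m : ℤ) + 1 - 4 = m - 3 by ring, zpow_sub₀ two_ne_zero]
    norm_num
    ring
  have hcpos : 0 < maxDistConst (m + 1) := by rw [hc]; positivity
  rw [neg_add, Real.exp_add, Real.exp_neg, Real.exp_log hcpos, h4, hc, capConst]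
  field_simp
  norm_num

/-- The factor `(b / a) ^ p` of the cap probability against the factor `exp r` of the radial
integral: what is left is of order `1 / log (a / b)`. -/
lemma rpow_mul_exp_distOffset {a b : ℝ} (ha : 0 < a) (hb : 0 < b) (p κ : ℝ)
    (hL : 0 < Real.log (a / b)) :
    (4 * (b / a)) ^ p * Real.exp (distOffset p κ (Real.log (a / b)))
      = 4 ^ p * Real.exp (-κ) / Real.log (a / b) := by
  have h1 : (b / a) ^ p = Real.exp (-(p * Real.log (a / b))) := by
    rw [Real.rpow_def_of_pos (by positivity), ← inv_div a b, Real.log_inv]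
    congr 1; ring
  rw [Real.mul_rpow (by norm_num) (by positivity), h1, distOffset, mul_assoc, ← Real.exp_add,
    show -(p * Real.log (a / b)) + (p * Real.log (a / b) - Real.log (Real.log (a / b)) - κ)
      = -κ - Real.log (Real.log (a / b)) by ring, Real.exp_sub, Real.exp_log hL]
  ring

section

variable {m : ℕ} {ν : Measure (EuclideanSpace ℝ (Fin (m + 1)))} [IsProbabilityMeasure ν]
  {a b : ℕ → ℝ}

lemma tendsto_log_ratio (ha : ∀ n, 0 < a n) (hb : ∀ n, 0 < b n) (hab : b =o[atTop] a) :
    Tendsto (fun n => Real.log (a n / b n)) atTop atTop := by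
  refine Real.tendsto_log_atTop.comp ?_
  have h : Tendsto (fun n => b n / a n) atTop (𝓝[>] 0) :=
    tendsto_nhdsWithin_iff.2 ⟨hab.tendsto_div_nhds_zero,
      Eventually.of_forall fun n => div_pos (hb n) (ha n)⟩
  refine (tendsto_inv_nhdsGT_zero.comp h).congr fun n => ?_
  simp

/-- The truncated set of distant pairs belonging to the parameters of the `n`-th sample. -/
noncomputable def farPairsSeq (m : ℕ) (a b : ℕ → ℝ) (κ : ℝ) (n : ℕ) :
    Set (EuclideanSpace ℝ (Fin (m + 1)) × EuclideanSpace ℝ (Fin (m + 1))) :=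
  farPairs _ (a n) (b n) (truncLevel (Real.log (a n / b n)))
    (distOffset (m / 2) κ (Real.log (a n / b n)))

lemma eventually_mul_log_ratio_lt {δ p : ℝ} (hδ : 0 < δ) (ha : ∀ n, 0 < a n) (hb : ∀ n, 0 < b n)
    (hab : b =o[atTop] a) :
    ∀ᶠ n in atTop, b n * (p * Real.log (a n / b n)) < δ * a n := by
  have hL := tendsto_log_ratio ha hb hab
  have h1 : Tendsto (fun x : ℝ => p * (x * Real.exp (-x))) atTop (𝓝 (p * 0)) := by
    refine Tendsto.const_mul p ?_
    simpa using Real.tendsto_pow_mul_exp_neg_atTop_nhds_zero 1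
  rw [mul_zero] at h1
  filter_upwards [(h1.comp hL).eventually (gt_mem_nhds hδ)] with n hn
  have ha' := ha n
  have hb' := hb n
  simp only [Function.comp_apply] at hn
  rw [Real.exp_neg, Real.exp_log (by positivity), inv_div] at hn
  calc b n * (p * Real.log (a n / b n))
      = p * (Real.log (a n / b n) * (b n / a n)) * a n := by field_simp
    _ < δ * a n := by gcongr

/-- The law `ν` of the points has radial tail `ν (|x| > a n + t b n) ∼ e ^ (-t) / n`, uniformly for
`|t| ≤ (m / 2) log (a n / b n)`. -/
def HasExpTail (ν : Measure (EuclideanSpace ℝ (Fin (m + 1)))) (a b : ℕ → ℝ) : Prop :=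
  ∀ ε : ℝ, 0 < ε → ∀ᶠ n : ℕ in atTop, ∀ t : ℝ, |t| ≤ (m : ℝ) / 2 * Real.log (a n / b n) →
    |ν.real {x | a n + t * b n < ‖x‖} - Real.exp (-t) / n| ≤ ε * (Real.exp (-t) / n)

lemma HasExpTail.eventually_radialMeasure_le (hm : 1 ≤ m) (ha : ∀ n, 0 < a n) (hb : ∀ n, 0 < b n)
    (hab : b =o[atTop] a) (htail : HasExpTail ν a b) {ε : ℝ} (hε : 0 < ε) :
    ∀ᶠ n : ℕ in atTop, ∀ t, -((m : ℝ) / 2 * Real.log (a n / b n)) ≤ t →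
      radialMeasure ν (a n) (b n) (truncLevel (Real.log (a n / b n))) (Set.Ioi t)
        ≤ ENNReal.ofReal ((1 + ε) / n * Real.exp (-t)) := by
  have hp : (0 : ℝ) < m / 2 := by
    have : (0 : ℝ) < m := by exact_mod_cast hm
    positivity
  filter_upwards [htail ε hε,
    (tendsto_log_ratio ha hb hab).eventually (eventually_offset_bounds hp 0)] with n h1 h2
  refine radialMeasure_Ioi_le ν (hb n) h2.2.2.1 fun t ht => ?_
  have := (abs_le.1 (h1 t ht)).2
  calc _ ≤ Real.exp (-t) / n + ε * (Real.exp (-t) / n) := by linarith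
    _ = _ := by ring

lemma HasExpTail.eventually_le_radialMeasure (hm : 1 ≤ m) (ha : ∀ n, 0 < a n) (hb : ∀ n, 0 < b n)
    (hab : b =o[atTop] a) (htail : HasExpTail ν a b) {ε : ℝ} (hε : 0 < ε) (M : ℝ) :
    ∀ᶠ n : ℕ in atTop, ∀ t, -((m : ℝ) / 2 * Real.log (a n / b n)) ≤ t → t ≤ M →
      ENNReal.ofReal ((1 - ε) / n * Real.exp (-t))
        ≤ radialMeasure ν (a n) (b n) (truncLevel (Real.log (a n / b n))) (Set.Ioi t) := by
  have hp : (0 : ℝ) < m / 2 := by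
    have : (0 : ℝ) < m := by exact_mod_cast hm
    positivity
  have hL := tendsto_log_ratio ha hb hab
  -- the mass beyond the truncation level is negligible against the mass beyond `M`
  have hA : Tendsto (fun n => (1 + ε / 2) * Real.exp (-truncLevel (Real.log (a n / b n)))) atTop
      (𝓝 ((1 + ε / 2) * 0)) :=
    (Real.tendsto_exp_neg_atTop_nhds_zero.comp (tendsto_truncLevel.comp hL)).const_mul _
  rw [mul_zero] at hA
  filter_upwards [htail (ε / 2) (by positivity), hL.eventually (eventually_offset_bounds hp 0),
    hA.eventually (gt_mem_nhds (show 0 < ε / 2 * Real.exp (-M) by positivity)),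
    (hL.const_mul_atTop hp).eventually_ge_atTop M] with n h1 h2 h3 h4
  have hA0 : |truncLevel (Real.log (a n / b n))| ≤ m / 2 * Real.log (a n / b n) := by
    rw [abs_of_nonneg h2.2.1]; exact h2.2.2.1
  intro t ht htM
  refine le_radialMeasure_Ioi ν (c := (1 - ε / 2) / n)
    (C := (1 + ε / 2) / n * Real.exp (-truncLevel (Real.log (a n / b n)))) (hb n) h4
    (fun t ht => ?_) ?_ ?_ (by positivity) t ht htM
  · have := (abs_le.1 (h1 t ht)).1
    calc _ = Real.exp (-t) / n - ε / 2 * (Real.exp (-t) / n) := by ring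
      _ ≤ _ := by linarith
  · have := (abs_le.1 (h1 _ hA0)).2
    refine le_trans (le_of_eq ?_) (sub_le_iff_le_add.1 this |>.trans (le_of_eq ?_))
    · rfl
    · ring
  · have : (1 + ε / 2) / n * Real.exp (-truncLevel (Real.log (a n / b n)))
        ≤ ε / 2 * Real.exp (-M) / n := by
      rw [div_mul_eq_mul_div]
      gcongr
    calc _ ≤ (1 - ε) / n * Real.exp (-M) + ε / 2 * Real.exp (-M) / n := by gcongr
      _ = _ := by ring

/-- The sections of the truncated set of distant pairs have measure `o(1 / n)`. -/
lemma HasExpTail.exists_section_bound (hm : 1 ≤ m) (hν : IsSphericallySymmetric ν)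
    (ha : ∀ n, 0 < a n) (hb : ∀ n, 0 < b n) (hab : b =o[atTop] a) (htail : HasExpTail ν a b)
    (κ : ℝ) : ∃ Q : ℕ → ℝ, (∀ n, 0 ≤ Q n) ∧ Tendsto (fun n : ℕ => n * Q n) atTop (𝓝 0) ∧
      ∀ᶠ n in atTop, ∀ x, ν {y | (x, y) ∈ farPairsSeq m a b κ n} ≤ ENNReal.ofReal (Q n) := by
  have hp : (0 : ℝ) < m / 2 := by
    have : (0 : ℝ) < m := by exact_mod_cast hm
    positivity
  have hL := tendsto_log_ratio ha hb hab
  have hG : 0 < Real.Gamma (m / 2 + 1) := Real.Gamma_pos_of_pos (by positivity)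
  have hc := capConst_pos m
  obtain ⟨δ, hδ, hbd⟩ := exists_farPairs_bounds hm 1 one_pos
  set Q : ℕ → ℝ := fun n => (1 + 1) * (capConst m * (4 * (b n / a n)) ^ (m / 2 : ℝ)) *
    ((1 + 1) / n * Real.Gamma (m / 2 + 1) * Real.exp (distOffset (m / 2) κ (Real.log (a n / b n))
      + truncLevel (Real.log (a n / b n)))) with hQ
  have hQ0 : ∀ n, 0 ≤ Q n := fun n => by
    have ha' := ha n
    have hb' := hb n
    simp only [hQ]
    positivity
  refine ⟨Q, hQ0, ?_, ?_⟩
  · have hlim : Tendsto (fun x : ℝ => 4 * capConst m * Real.Gamma (m / 2 + 1) *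
        (4 ^ (m / 2 : ℝ) * Real.exp (-κ)) * Real.exp (-truncLevel x)) atTop
        (𝓝 (4 * capConst m * Real.Gamma (m / 2 + 1) * (4 ^ (m / 2 : ℝ) * Real.exp (-κ)) * 0)) :=
      (Real.tendsto_exp_neg_atTop_nhds_zero.comp tendsto_truncLevel).const_mul _
    rw [mul_zero] at hlim
    refine (hlim.comp hL).congr' ?_
    filter_upwards [hL.eventually_gt_atTop 0, eventually_gt_atTop 0] with n hn hn0
    have hn' : (n : ℝ) ≠ 0 := by positivity
    have hkey := rpow_mul_exp_distOffset (ha n) (hb n) (m / 2) κ hn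
    have hexp : Real.exp (truncLevel (Real.log (a n / b n))) / Real.log (a n / b n)
        = Real.exp (-truncLevel (Real.log (a n / b n))) := by
      have h2 : Real.exp (2 * truncLevel (Real.log (a n / b n))) = Real.log (a n / b n) := by
        rw [truncLevel, mul_div_cancel₀ _ two_ne_zero, Real.exp_log hn]
      rw [div_eq_iff hn.ne']
      nth_rewrite 3 [← h2]
      rw [← Real.exp_add]
      congr 1
      ring
    simp only [Function.comp_apply, hQ]
    rw [← hexp, Real.exp_add]
    calc _ = 4 * capConst m * Real.Gamma (m / 2 + 1) *
          (4 ^ (m / 2 : ℝ) * Real.exp (-κ) / Real.log (a n / b n)) *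
          Real.exp (truncLevel (Real.log (a n / b n))) := by ring
      _ = _ := by
          rw [← hkey]
          field_simp
          ring
  · filter_upwards [htail.eventually_radialMeasure_le hm ha hb hab one_pos,
      hL.eventually (eventually_offset_bounds hp κ), eventually_mul_log_ratio_lt (p := m / 2) hδ ha hb hab]
      with n h1 h2 h3 x
    obtain ⟨h4, h5, h6, h7, h8, h9⟩ := h2
    by_cases hx : ‖x‖ ≤ a n + b n * truncLevel (Real.log (a n / b n))
    · refine ((hbd ν hν (a n) (b n) _ _ _ (ha n) (hb n) h3 h6 h7 h8).1 x hx).trans ?_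
      have hxA : (‖x‖ - a n) / b n ≤ truncLevel (Real.log (a n / b n)) := by
        rw [div_le_iff₀ (hb n)]; linarith
      have ha' := ha n
      have hb' := hb n
      have hin : ∫⁻ t, ENNReal.ofReal (max (distOffset (m / 2) κ (Real.log (a n / b n))
            + (‖x‖ - a n) / b n + t) 0 ^ (m / 2 : ℝ))
            ∂(radialMeasure ν (a n) (b n) (truncLevel (Real.log (a n / b n))))
          ≤ ENNReal.ofReal ((1 + 1) / n * Real.Gamma (m / 2 + 1) *
            Real.exp (distOffset (m / 2) κ (Real.log (a n / b n))
              + truncLevel (Real.log (a n / b n)))) := by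
        refine (lintegral_max_add_rpow_le hp (by positivity) h1 (by linarith)).trans ?_
        gcongr
      exact (mul_le_mul_right hin _).trans (le_of_eq (ENNReal.ofReal_mul (by positivity)).symm)
    · have : {y | (x, y) ∈ farPairsSeq m a b κ n} = ∅ := by
        ext y
        simp only [Set.mem_ofPred_eq, Set.mem_empty_iff_false, iff_false]
        exact fun h => hx h.2.1
      rw [this, measure_empty]
      exact zero_le

lemma HasExpTail.eventually_measure_farPairsSeq_le (hm : 1 ≤ m) (hν : IsSphericallySymmetric ν)
    (ha : ∀ n, 0 < a n) (hb : ∀ n, 0 < b n) (hab : b =o[atTop] a) (htail : HasExpTail ν a b)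
    (κ : ℝ) {ε : ℝ} (hε : 0 < ε) :
    ∀ᶠ n : ℕ in atTop, (n : ℝ) ^ 2 * (ν.prod ν).real (farPairsSeq m a b κ n)
      ≤ (1 + ε) ^ 3 * (capConst m * 4 ^ (m / 2 : ℝ) * Real.exp (-κ) * Real.Gamma (m / 2 + 1)) *
        ((2 * truncLevel (Real.log (a n / b n)) + distOffset (m / 2) κ (Real.log (a n / b n)) + 1)
          / Real.log (a n / b n)) := by
  have hp : (0 : ℝ) < m / 2 := by
    have : (0 : ℝ) < m := by exact_mod_cast hm
    positivity
  have hL := tendsto_log_ratio ha hb hab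
  have hG : 0 < Real.Gamma (m / 2 + 1) := Real.Gamma_pos_of_pos (by positivity)
  have hc := capConst_pos m
  obtain ⟨δ, hδ, hbd⟩ := exists_farPairs_bounds hm ε hε
  filter_upwards [htail.eventually_radialMeasure_le hm ha hb hab hε,
    hL.eventually (eventually_offset_bounds hp κ), eventually_mul_log_ratio_lt (p := m / 2) hδ ha hb hab,
    eventually_gt_atTop 0] with n h1 h2 h3 hn0
  obtain ⟨h4, h5, h6, h7, h8, h9⟩ := h2
  have ha' := ha n
  have hb' := hb n
  have hn' : (0 : ℝ) < n := by positivity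
  have hkey := rpow_mul_exp_distOffset ha' hb' (m / 2) κ h4
  have hI := (hbd ν hν (a n) (b n) _ _ _ (ha n) (hb n) h3 h6 h7 h8).2.1
  have hI2 := lintegral_lintegral_rpow_le hp (c := (1 + ε) / n) (by positivity) h1
    (radialMeasure_Ioi_self ν hb' _) h8 (by linarith)
  have hI3 := hI.trans (mul_le_mul_right hI2 _)
  rw [← ENNReal.ofReal_mul (by positivity)] at hI3
  have hI4 := ENNReal.toReal_le_of_le_ofReal (by positivity) hI3
  calc _ ≤ (n : ℝ) ^ 2 * _ := mul_le_mul_of_nonneg_left hI4 (by positivity)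
    _ = (1 + ε) ^ 3 * capConst m * Real.Gamma (m / 2 + 1) * ((4 * (b n / a n)) ^ (m / 2 : ℝ) *
          Real.exp (distOffset (m / 2) κ (Real.log (a n / b n)))) *
          (2 * truncLevel (Real.log (a n / b n)) + distOffset (m / 2) κ (Real.log (a n / b n)) + 1) := by
        field_simp
    _ = _ := by rw [hkey]; ring

lemma HasExpTail.eventually_le_measure_farPairsSeq (hm : 1 ≤ m) (hν : IsSphericallySymmetric ν)
    (ha : ∀ n, 0 < a n) (hb : ∀ n, 0 < b n) (hab : b =o[atTop] a) (htail : HasExpTail ν a b)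
    (κ : ℝ) {ε : ℝ} (hε : 0 < ε) (hε1 : ε ≤ 1) {M : ℝ} (hM : 0 ≤ M) :
    ∀ᶠ n : ℕ in atTop,
      (1 - ε) ^ 3 * (capConst m * 4 ^ (m / 2 : ℝ) * Real.exp (-κ) * truncatedGamma (m / 2) M) *
        (distOffset (m / 2) κ (Real.log (a n / b n)) / Real.log (a n / b n))
      ≤ (n : ℝ) ^ 2 * (ν.prod ν).real (farPairsSeq m a b κ n) := by
  have hp : (0 : ℝ) < m / 2 := by
    have : (0 : ℝ) < m := by exact_mod_cast hm
    positivity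
  have hL := tendsto_log_ratio ha hb hab
  have hG := truncatedGamma_nonneg hp M
  have hc := capConst_pos m
  have hε' : 0 ≤ 1 - ε := by linarith
  obtain ⟨δ, hδ, hbd⟩ := exists_farPairs_bounds hm ε hε
  filter_upwards [htail.eventually_le_radialMeasure hm ha hb hab hε M,
    hL.eventually (eventually_offset_bounds hp κ), eventually_mul_log_ratio_lt (p := m / 2) hδ ha hb hab,
    eventually_gt_atTop 0] with n h1 h2 h3 hn0
  obtain ⟨h4, h5, h6, h7, h8, h9⟩ := h2
  have ha' := ha n
  have hb' := hb n
  have hn' : (0 : ℝ) < n := by positivity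
  have hkey := rpow_mul_exp_distOffset ha' hb' (m / 2) κ h4
  have hI := (hbd ν hν (a n) (b n) _ _ _ (ha n) (hb n) h3 h6 h7 h8).2.2
  have hI2 := le_lintegral_lintegral_rpow hp (c := (1 - ε) / n) (by positivity) h1
    (radialMeasure_Ioi_self ν hb' _) hM h5 h8
  have hI3 := (mul_le_mul_right hI2 _).trans hI
  rw [← ENNReal.ofReal_mul (by positivity)] at hI3
  have hI4 := (ENNReal.ofReal_le_iff_le_toReal (measure_ne_top _ _)).1 hI3
  calc _ = (1 - ε) ^ 3 * capConst m * truncatedGamma (m / 2) M * ((4 * (b n / a n)) ^ (m / 2 : ℝ) *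
          Real.exp (distOffset (m / 2) κ (Real.log (a n / b n)))) *
          distOffset (m / 2) κ (Real.log (a n / b n)) := by rw [hkey]; ring
    _ = (n : ℝ) ^ 2 * _ := by
        field_simp
    _ ≤ (n : ℝ) ^ 2 * _ := mul_le_mul_of_nonneg_left hI4 (by positivity)

/-- The mean number of distant truncated pairs converges. -/
lemma HasExpTail.tendsto_sq_mul_measure_farPairsSeq (hm : 1 ≤ m) (hν : IsSphericallySymmetric ν)
    (ha : ∀ n, 0 < a n) (hb : ∀ n, 0 < b n) (hab : b =o[atTop] a) (htail : HasExpTail ν a b)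
    (l : ℝ) :
    Tendsto (fun n : ℕ => (n : ℝ) ^ 2 * (ν.prod ν).real
      (farPairsSeq m a b (Real.log (maxDistConst (m + 1)) + l) n)) atTop
      (𝓝 (2 * Real.exp (-l))) := by
  have hp : (0 : ℝ) < m / 2 := by
    have : (0 : ℝ) < m := by exact_mod_cast hm
    positivity
  have hL := tendsto_log_ratio ha hb hab
  set κ := Real.log (maxDistConst (m + 1)) + l with hκ
  set C := capConst m * 4 ^ (m / 2 : ℝ) * Real.exp (-κ) with hC
  have hconst : C * Real.Gamma (m / 2 + 1) * (m / 2) = 2 * Real.exp (-l) := capConst_mul_eq hm l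
  have hk : Tendsto (fun k : ℕ => 1 / ((k : ℝ) + 1)) atTop (𝓝 0) :=
    tendsto_one_div_add_atTop_nhds_zero_nat
  have hk1 : ∀ k : ℕ, 0 < 1 / ((k : ℝ) + 1) := fun k => by positivity
  have hk2 : ∀ k : ℕ, 1 / ((k : ℝ) + 1) ≤ 1 := fun k => by
    rw [div_le_one (by positivity)]
    have : (0 : ℝ) ≤ k := by positivity
    linarith
  rw [tendsto_order]
  constructor
  · intro c hc
    have h1 : Tendsto (fun k : ℕ => (1 - 1 / ((k : ℝ) + 1)) ^ 3 *
        (C * truncatedGamma (m / 2) k) * (m / 2)) atTop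
        (𝓝 ((1 - 0) ^ 3 * (C * Real.Gamma (m / 2 + 1)) * (m / 2))) :=
      (((hk.const_sub 1).pow 3).mul (((tendsto_truncatedGamma hp).comp
        tendsto_natCast_atTop_atTop).const_mul C)).mul_const _
    rw [sub_zero, one_pow, one_mul, hconst] at h1
    obtain ⟨k, hck⟩ := (h1.eventually (lt_mem_nhds hc)).exists
    have h2 := ((tendsto_distOffset_div (m / 2) κ).comp hL).const_mul
      ((1 - 1 / ((k : ℝ) + 1)) ^ 3 * (C * truncatedGamma (m / 2) k))
    filter_upwards [h2.eventually (lt_mem_nhds hck),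
      htail.eventually_le_measure_farPairsSeq hm hν ha hb hab κ (hk1 k) (hk2 k)
        (show (0 : ℝ) ≤ k by positivity)] with n h3 h4
    exact h3.trans_le h4
  · intro c hc
    have h1 : Tendsto (fun k : ℕ => (1 + 1 / ((k : ℝ) + 1)) ^ 3 *
        (C * Real.Gamma (m / 2 + 1)) * (m / 2)) atTop
        (𝓝 ((1 + 0) ^ 3 * (C * Real.Gamma (m / 2 + 1)) * (m / 2))) :=
      (((hk.const_add 1).pow 3).mul_const _).mul_const _
    rw [add_zero, one_pow, one_mul, hconst] at h1
    obtain ⟨k, hck⟩ := (h1.eventually (gt_mem_nhds hc)).exists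
    have h2 := ((tendsto_truncLevel_add_distOffset_div (m / 2) κ).comp hL).const_mul
      ((1 + 1 / ((k : ℝ) + 1)) ^ 3 * (C * Real.Gamma (m / 2 + 1)))
    filter_upwards [h2.eventually (gt_mem_nhds hck),
      htail.eventually_measure_farPairsSeq_le hm hν ha hb hab κ (hk1 k)] with n h3 h4
    exact h4.trans_lt h3

end

/-! ### Convergence of the number of distant pairs and of the maximal distance -/

lemma numFarPairs_eq_pairCount {d : ℕ} (n : ℕ) (r : ℝ) (x : ℕ → EuclideanSpace ℝ (Fin d)) :
    numFarPairs n r x = pairCount {z | r < ‖z.1 - z.2‖} (orderedPairs n) x := by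
  classical
  unfold numFarPairs pairCount
  refine Finset.card_bij (fun p _ => ((p.1 : ℕ), (p.2 : ℕ))) ?_ ?_ ?_
  · intro p hp
    simp only [Finset.mem_filter, Finset.mem_univ, true_and, mem_orderedPairs,
      Set.mem_ofPred_eq] at hp ⊢
    exact ⟨⟨hp.1, p.2.2⟩, hp.2⟩
  · intro p _ q _ h
    simp only [Prod.mk.injEq] at h
    exact Prod.ext (Fin.ext h.1) (Fin.ext h.2)
  · intro q hq
    simp only [Finset.mem_filter, mem_orderedPairs, Set.mem_ofPred_eq] at hq
    exact ⟨(⟨q.1, by omega⟩, ⟨q.2, by omega⟩), by simpa using ⟨hq.1.1, hq.2⟩, rfl⟩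

lemma maxInterpointDist_le_iff {d n : ℕ} (hn : 2 ≤ n) (r : ℝ)
    (x : ℕ → EuclideanSpace ℝ (Fin d)) :
    maxInterpointDist n x ≤ r ↔ numFarPairs n r x = 0 := by
  have : Nonempty {p : Fin n × Fin n // p.1 < p.2} :=
    ⟨⟨(⟨0, by omega⟩, ⟨1, by omega⟩), by simp⟩⟩
  rw [maxInterpointDist, ciSup_le_iff (Set.finite_range _).bddAbove, numFarPairs,
    Finset.card_eq_zero, Finset.filter_eq_empty_iff]
  simp only [Finset.mem_univ, forall_true_left, not_and, not_lt, Subtype.forall]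

section

variable {d : ℕ} {Ω : Type*} [MeasurableSpace Ω] {X : ℕ → Ω → EuclideanSpace ℝ (Fin d)}

lemma measurable_maxInterpointDist (hX : ∀ i, Measurable (X i)) (n : ℕ) :
    Measurable fun ω => maxInterpointDist n fun i => X i ω := by
  unfold maxInterpointDist
  exact Measurable.iSup fun p => ((hX _).sub (hX _)).norm

lemma measurable_numFarPairs (hX : ∀ i, Measurable (X i)) (n : ℕ) (r : ℝ) :
    Measurable fun ω => numFarPairs n r fun i => X i ω := by
  simp_rw [numFarPairs_eq_pairCount]
  exact measurable_pairCount_comp hX (measurableSet_lt measurable_const (by fun_prop)) _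

end

/-- Truncating the radii changes the law of the number of distant pairs by at most the probability
that one of the points is beyond the truncation radius. -/
lemma abs_measureReal_numFarPairs_sub_le {d : ℕ} {Ω : Type*} [MeasurableSpace Ω] {P : Measure Ω}
    [IsProbabilityMeasure P] {X : ℕ → Ω → EuclideanSpace ℝ (Fin d)} (hX : ∀ i, Measurable (X i))
    (hid : ∀ i, IdentDistrib (X i) (X 0) P P) (n k : ℕ) (a b A r : ℝ) :
    |P.real {ω | numFarPairs n (2 * a - b * r) (fun i => X i ω) = k}
      - P.real {ω | pairCount (farPairs _ a b A r) (orderedPairs n) (fun i => X i ω) = k}|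
      ≤ n * (P.map (X 0)).real {x | a + A * b < ‖x‖} := by
  have hm := measurableSet_farPairs (E := EuclideanSpace ℝ (Fin d)) a b A r
  have hAm : MeasurableSet {x : EuclideanSpace ℝ (Fin d) | a + A * b < ‖x‖} :=
    measurableSet_lt (by fun_prop) (by fun_prop)
  refine (abs_measureReal_sub_le_measureReal_symmDiff
    (measurable_numFarPairs hX n _ (measurableSet_singleton k)).nullMeasurableSet
    (measurable_pairCount_comp hX hm _ (measurableSet_singleton k)).nullMeasurableSet).trans ?_
  have hs : symmDiff {ω | numFarPairs n (2 * a - b * r) (fun i => X i ω) = k}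
      {ω | pairCount (farPairs _ a b A r) (orderedPairs n) (fun i => X i ω) = k}
      ⊆ ⋃ i ∈ Finset.range n, {ω | a + A * b < ‖X i ω‖} := by
    intro ω hω
    by_contra hcon
    simp only [Set.mem_iUnion, Finset.mem_range, Set.mem_ofPred_eq, not_exists, not_lt] at hcon
    have heq : numFarPairs n (2 * a - b * r) (fun i => X i ω)
        = pairCount (farPairs _ a b A r) (orderedPairs n) (fun i => X i ω) := by
      classical
      rw [numFarPairs_eq_pairCount, pairCount, pairCount]
      congr 1
      refine Finset.filter_congr fun p hp => ?_
      rw [mem_orderedPairs] at hp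
      simp only [farPairs, Set.mem_ofPred_eq]
      have h1 := hcon p.1 (by omega)
      have h2 := hcon p.2 hp.2
      rw [mul_comm A b] at h1 h2
      tauto
    rcases hω with h | h
    · exact h.2 (heq.symm.trans h.1)
    · exact h.2 (heq.trans h.1)
  calc _ ≤ P.real (⋃ i ∈ Finset.range n, {ω | a + A * b < ‖X i ω‖}) :=
        measureReal_mono hs (measure_ne_top _ _)
    _ ≤ ∑ i ∈ Finset.range n, P.real {ω | a + A * b < ‖X i ω‖} :=
        measureReal_biUnion_finset_le _ _
    _ = ∑ i ∈ Finset.range n, (P.map (X 0)).real {x | a + A * b < ‖x‖} := by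
        refine Finset.sum_congr rfl fun i _ => ?_
        rw [← (hid i).map_eq, map_measureReal_apply (hX i) hAm]
        rfl
    _ = _ := by rw [Finset.sum_const, Finset.card_range, nsmul_eq_mul]

/-- The probabilities `P(W = k)` of the number `W` of distant pairs converge to those of the Poisson
law with mean `exp (-l)`. -/
lemma tendsto_measureReal_numFarPairs {m : ℕ} (hm : 1 ≤ m) {Ω : Type*} [MeasurableSpace Ω]
    {P : Measure Ω} [IsProbabilityMeasure P] {X : ℕ → Ω → EuclideanSpace ℝ (Fin (m + 1))}
    (hX : ∀ i, Measurable (X i)) (hind : iIndepFun X P)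
    (hid : ∀ i, IdentDistrib (X i) (X 0) P P) (hsymm : IsSphericallySymmetric (P.map (X 0)))
    {a b : ℕ → ℝ} (ha : ∀ n, 0 < a n) (hb : ∀ n, 0 < b n) (hab : b =o[atTop] a)
    (htail : HasExpTail (P.map (X 0)) a b) (l : ℝ) (k : ℕ) :
    Tendsto (fun n : ℕ => P.real {ω | numFarPairs n (2 * a n - b n *
      distOffset (m / 2) (Real.log (maxDistConst (m + 1)) + l) (Real.log (a n / b n)))
        (fun i => X i ω) = k}) atTop
      (𝓝 (Real.exp (-Real.exp (-l)) * Real.exp (-l) ^ k / k.factorial)) := by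
  have : IsProbabilityMeasure (P.map (X 0)) := Measure.isProbabilityMeasure_map (hX 0).aemeasurable
  have hp : (0 : ℝ) < m / 2 := by
    have : (0 : ℝ) < m := by exact_mod_cast hm
    positivity
  set κ := Real.log (maxDistConst (m + 1)) + l with hκ
  have hL := tendsto_log_ratio ha hb hab
  obtain ⟨Q, hQ0, hQlim, hQ⟩ := htail.exists_section_bound hm hsymm ha hb hab κ
  have hBm : ∀ n, MeasurableSet (farPairsSeq m a b κ n) := fun n => measurableSet_farPairs _ _ _ _
  have hpois := tendsto_measureReal_pairCount hX hind hid hBm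
    (fun n x y h => farPairs_symm x y h) hQ0 hQ hQlim (Real.exp_pos (-l)).le
    (htail.tendsto_sq_mul_measure_farPairsSeq hm hsymm ha hb hab l) k
  have hdiff : Tendsto (fun n : ℕ => P.real {ω | numFarPairs n (2 * a n - b n *
      distOffset (m / 2) κ (Real.log (a n / b n))) (fun i => X i ω) = k}
      - P.real {ω | pairCount (farPairsSeq m a b κ n) (orderedPairs n) (fun i => X i ω) = k})
      atTop (𝓝 0) := by
    have hA : Tendsto (fun n => 2 * Real.exp (-truncLevel (Real.log (a n / b n)))) atTop
        (𝓝 (2 * 0)) :=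
      (Real.tendsto_exp_neg_atTop_nhds_zero.comp (tendsto_truncLevel.comp hL)).const_mul _
    rw [mul_zero] at hA
    refine squeeze_zero_norm' ?_ hA
    filter_upwards [htail 1 one_pos, hL.eventually (eventually_offset_bounds hp 0),
      eventually_gt_atTop 0] with n h1 h2 hn
    have hn' : (0 : ℝ) < n := by exact_mod_cast hn
    refine (abs_measureReal_numFarPairs_sub_le hX hid n k (a n) (b n) _ _).trans ?_
    have h3 := (abs_le.1 (h1 (truncLevel (Real.log (a n / b n)))
      (by rw [abs_of_nonneg h2.2.1]; exact h2.2.2.1))).2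
    calc _ ≤ (n : ℝ) * (2 * (Real.exp (-truncLevel (Real.log (a n / b n))) / n)) := by
          gcongr
          linarith
      _ = _ := by field_simp
  simpa using hdiff.add hpois

lemma tendstoInDistribution_nat_of_tendsto_singleton {Ω : Type*} [MeasurableSpace Ω]
    {P : Measure Ω} [IsProbabilityMeasure P] {W : ℕ → Ω → ℕ} (hW : ∀ n, Measurable (W n))
    {μ : Measure ℕ} [IsProbabilityMeasure μ]
    (h : ∀ k, Tendsto (fun n => P.real {ω | W n ω = k}) atTop (𝓝 (μ.real {k}))) :
    TendstoInDistribution W atTop (id : ℕ → ℕ) (fun _ => P) μ where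
  forall_aemeasurable n := (hW n).aemeasurable
  aemeasurable_limit := aemeasurable_id
  tendsto := by
    refine IsPiSystem.tendsto_probabilityMeasure_of_tendsto_of_mem
      (S := Set.range fun k : ℕ => ({k} : Set ℕ)) ?_ ?_ ?_ ?_
    · rintro _ ⟨j, rfl⟩ _ ⟨k, rfl⟩ ⟨x, hx⟩
      obtain ⟨rfl, rfl⟩ : x = j ∧ x = k := hx
      exact ⟨x, by simp⟩
    · rintro _ ⟨k, rfl⟩
      exact measurableSet_singleton k
    · intro u _ x hx
      exact ⟨{x}, ⟨x, rfl⟩, by simp, by simpa using hx⟩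
    · rintro _ ⟨k, rfl⟩
      rw [← NNReal.tendsto_coe]
      simp only [ProbabilityMeasure.mk_apply, ENNReal.coe_toNNReal_eq_toReal]
      have := h k
      refine (this.congr fun n => ?_).trans (le_of_eq ?_)
      · rw [measureReal_def, Measure.map_apply (hW n) (measurableSet_singleton k)]
        rfl
      · rw [Measure.map_id]
        rfl

lemma tendstoInDistribution_gumbel_of_tendsto_cdf {Ω : Type*} [MeasurableSpace Ω]
    {P : Measure Ω} [IsProbabilityMeasure P] {Z : ℕ → Ω → ℝ} (hZ : ∀ n, Measurable (Z n))
    (h : ∀ x : ℝ, Tendsto (fun n => P.real {ω | Z n ω ≤ x}) atTop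
      (𝓝 (Real.exp (-Real.exp (-x))))) :
    TendstoInDistribution Z atTop (id : ℝ → ℝ) (fun _ => P) gumbelMeasure where
  forall_aemeasurable n := (hZ n).aemeasurable
  aemeasurable_limit := aemeasurable_id
  tendsto := by
    refine IsPiSystem.tendsto_probabilityMeasure_of_tendsto_of_mem
      (S := {S | ∃ i j : ℝ, id i < id j ∧ Set.Ioc (id i) (id j) = S})
      (isPiSystem_Ioc id id) ?_ ?_ ?_
    · rintro _ ⟨i, j, _, rfl⟩
      exact measurableSet_Ioc
    · intro u hu x hx
      obtain ⟨ε, hε, hball⟩ := Metric.isOpen_iff.1 hu x hx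
      refine ⟨Set.Ioc (x - ε / 2) (x + ε / 2), ⟨x - ε / 2, x + ε / 2, by simp only [id]; linarith, rfl⟩,
        Ioc_mem_nhds (by linarith) (by linarith), fun y hy => hball ?_⟩
      rw [Metric.mem_ball, Real.dist_eq, abs_lt]
      constructor <;> linarith [hy.1, hy.2]
    · rintro _ ⟨i, j, hij, rfl⟩
      simp only [id] at hij ⊢
      rw [← NNReal.tendsto_coe]
      simp only [ProbabilityMeasure.mk_apply, ENNReal.coe_toNNReal_eq_toReal]
      refine (((h j).sub (h i)).congr fun n => ?_).trans (le_of_eq ?_)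
      · rw [← measureReal_def, map_measureReal_apply (hZ n) measurableSet_Ioc,
          show Z n ⁻¹' Set.Ioc i j = {ω | Z n ω ≤ j} \ {ω | Z n ω ≤ i} by
            ext ω; simp [and_comm],
          measureReal_sdiff (s₁ := {ω | Z n ω ≤ j}) (s₂ := {ω | Z n ω ≤ i})
            (fun ω hω => le_trans hω hij.le)
            (hZ n measurableSet_Iic)]
      · have hmono : (0 : ℝ) ≤ Real.exp (-Real.exp (-j)) - Real.exp (-Real.exp (-i)) :=
          sub_nonneg.2 (gumbelCDF.mono hij.le)
        rw [Measure.map_id, gumbelMeasure, StieltjesFunction.measure_Ioc]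
        change 𝓝 (Real.exp (-Real.exp (-j)) - Real.exp (-Real.exp (-i))) = 𝓝 (ENNReal.ofReal
          (Real.exp (-Real.exp (-j)) - Real.exp (-Real.exp (-i)))).toReal
        rw [ENNReal.toReal_ofReal hmono]

theorem theorem1 {d : ℕ} (hd : 2 ≤ d)
    {Ω : Type*} [MeasurableSpace Ω] (P : Measure Ω) [IsProbabilityMeasure P]
    (X : ℕ → Ω → EuclideanSpace ℝ (Fin d))
    (hX_meas : ∀ i, Measurable (X i))
    (hX_indep : iIndepFun X P)
    (hX_ident : ∀ i, IdentDistrib (X i) (X 0) P P)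
    (hX_symm : IsSphericallySymmetric (P.map (X 0)))
    (a b : ℕ → ℝ) (ha : ∀ n, 0 < a n) (hb : ∀ n, 0 < b n) (hab : b =o[atTop] a)
    (htail : ∀ ε : ℝ, 0 < ε → ∀ᶠ n : ℕ in atTop, ∀ t : ℝ,
      |t| ≤ ((d : ℝ) - 1) / 2 * Real.log (a n / b n) →
        |P.real {ω | a n + t * b n < ‖X 0 ω‖} - Real.exp (-t) / n| ≤ ε * (Real.exp (-t) / n)) :
    (∀ l : ℝ, Tendsto
      (fun n : ℕ => P.real {ω | maxInterpointDist n (fun i => X i ω) ≤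
        2 * a n - b n * (((d : ℝ) - 1) / 2 * Real.log (a n / b n)
          - Real.log (Real.log (a n / b n)) - Real.log (maxDistConst d) - l)})
      atTop (𝓝 (Real.exp (-Real.exp (-l))))) ∧
    TendstoInDistribution
      (fun (n : ℕ) (ω : Ω) => (maxInterpointDist n (fun i => X i ω) - 2 * a n) / b n
        + ((d : ℝ) - 1) / 2 * Real.log (a n / b n)
        - Real.log (Real.log (a n / b n)) - Real.log (maxDistConst d))
      atTop (id : ℝ → ℝ) (fun _ => P) gumbelMeasure ∧
    (∀ l : ℝ, TendstoInDistribution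
      (fun (n : ℕ) (ω : Ω) => numFarPairs n
        (2 * a n - b n * (((d : ℝ) - 1) / 2 * Real.log (a n / b n)
          - Real.log (Real.log (a n / b n)) - Real.log (maxDistConst d) - l))
        (fun i => X i ω))
      atTop (id : ℕ → ℕ) (fun _ => P) (poissonMeasure (Real.toNNReal (Real.exp (-l))))) := by

  obtain ⟨m, rfl⟩ : ∃ m, d = m + 1 := ⟨d - 1, by omega⟩
  have hm : 1 ≤ m := by omega
  have hcast : (((m + 1 : ℕ) : ℝ) - 1) / 2 = m / 2 := by push_cast; ring
  have hoff : ∀ (n : ℕ) (l : ℝ), (((m + 1 : ℕ) : ℝ) - 1) / 2 * Real.log (a n / b n)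
      - Real.log (Real.log (a n / b n)) - Real.log (maxDistConst (m + 1)) - l
      = distOffset (m / 2) (Real.log (maxDistConst (m + 1)) + l) (Real.log (a n / b n)) := by
    intro n l
    rw [hcast, distOffset]; ring
  have htail' : HasExpTail (P.map (X 0)) a b := by
    intro ε hε
    filter_upwards [htail ε hε] with n hn t ht
    rw [map_measureReal_apply (hX_meas 0) (measurableSet_lt (by fun_prop) (by fun_prop))]
    exact hn t (by rw [hcast]; exact ht)
  have hmain := tendsto_measureReal_numFarPairs hm hX_meas hX_indep hX_ident hX_symm ha hb hab htail'
  have h1 : ∀ l : ℝ, Tendsto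
      (fun n : ℕ => P.real {ω | maxInterpointDist n (fun i => X i ω) ≤
        2 * a n - b n * ((((m + 1 : ℕ) : ℝ) - 1) / 2 * Real.log (a n / b n)
          - Real.log (Real.log (a n / b n)) - Real.log (maxDistConst (m + 1)) - l)})
      atTop (𝓝 (Real.exp (-Real.exp (-l)))) := by
    intro l
    have h := hmain l 0
    simp only [pow_zero, mul_one, Nat.factorial_zero, Nat.cast_one, div_one] at h
    refine h.congr' ?_
    filter_upwards [eventually_ge_atTop 2] with n hn
    simp_rw [hoff, maxInterpointDist_le_iff hn]
  refine ⟨h1, tendstoInDistribution_gumbel_of_tendsto_cdf (fun n => ?_) fun x => ?_, fun l => ?_⟩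
  · have := measurable_maxInterpointDist hX_meas n
    fun_prop
  · refine (h1 x).congr fun n => ?_
    congr 1
    ext ω
    simp only [Set.mem_ofPred_eq]
    rw [← sub_le_sub_iff_right (2 * a n), ← div_le_div_iff_of_pos_right (hb n)]
    rw [show (2 * a n - b n * ((((m + 1 : ℕ) : ℝ) - 1) / 2 * Real.log (a n / b n)
      - Real.log (Real.log (a n / b n)) - Real.log (maxDistConst (m + 1)) - x) - 2 * a n) / b n
      = -((((m + 1 : ℕ) : ℝ) - 1) / 2 * Real.log (a n / b n)
      - Real.log (Real.log (a n / b n)) - Real.log (maxDistConst (m + 1)) - x) by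
        have := (hb n).ne'
        field_simp
        ring]
    constructor <;> intro h <;> linarith
  · refine tendstoInDistribution_nat_of_tendsto_singleton
      (fun n => measurable_numFarPairs hX_meas n _) fun k => ?_
    rw [poissonMeasure_real_singleton, Real.coe_toNNReal _ (Real.exp_pos _).le]
    simp_rw [hoff]
    exact hmain l k
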